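/- Let $a(n,t)>0$ and $b(n,t)$, $n\in\mathbb{Z}$, be real and such that, at the time $t$ considered, $\sum_{n}|n|^l\big(|a(n,t)-\tfrac12|+|b(n,t)|\big)<\infty$ for every $l\in\mathbb{N}$ (for instance a decaying solution of the Toda lattice). For $0<|z|\le 1$ let $\psi_\pm(z,\cdot,t)$ be the Jost functions, i.e. the unique solutions of $$a(n,t)\psi(n+1)+a(n-1,t)\psi(n-1)+b(n,t)\psi(n)=\tfrac12(z+z^{-1})\,\psi(n),\qquad n\in\mathbb{Z},$$ with $\lim_{n\to\pm\infty}z^{\mp n}\psi_\pm(z,n,t)=1$. Let $T(z)$ be the transmission coefficient, i.e. the meromorphic function in the unit disc whose boundary values satisfy $T\psi_\mp=\overline{\psi_\pm}+R_\pm\psi_\pm$ for $|z|=1$, with coefficients $R_\pm(z,t)$ independent of $n$; explicitly $T(z)=\dfrac{z^{-1}-z}{2W(z)}$ with $W(z)=a(n,t)\big(\psi_+(z,n,t)\psi_-(z,n+1,t)-\psi_+(z,n+1,t)\psi_-(z,n,t)\big)$, which does not depend on $n$. For $n\in\mathbb{Z}$ put $$m(z,n,t)=\begin{cases}\begin{pmatrix}T(z)\psi_-(z,n,t)z^n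 & \psi_+(z,n,t)z^{-n}\end{pmatrix}, & |z|<1,\\[2pt] \begin{pmatrix}\psi_+(z^{-1},n,t)z^n & T(z^{-1})\psi_-(z^{-1},n,t)z^{-n}\end{pmatrix}, & |z|>1,\end{cases}$$ where values at removable singularities are limits, and values at $|z|=1$ are the boundary values from $|z|<1$ or from $|z|>1$. If $m(z_1,n,t)=\begin{pmatrix}0&0\end{pmatrix}$ for some $z_1\in\mathbb{C}$ (for $|z_1|=1$: from at least one of the two sides), then $z_1=\pm1$. Moreover, in this case at least one component $m_j$ has a simple zero at $z_1$: for each of the two regions $|z|<1$ and $|z|>1$, the limit of $m_j(z,n,t)/(z-z_1)$ as $z\to z_1$ within the region exists, is finite and is nonzero. -/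

import Mathlib

open Filter Topology

/-! Scattering theory of a Jacobi operator
`(H f)(n) = a(n) f(n+1) + a(n-1) f(n-1) + b(n) f(n)` on `ℤ`, with `a, b` real,
in the variable `z`, where the spectral parameter is `λ = (z + z⁻¹) / 2`. -/

/-- `a > 0` and `∑ₙ |n|^l (|a(n) - 1/2| + |b(n)|) < ∞` for every `l`. -/
structure JacobiDecay (a b : ℤ → ℝ) : Prop where
  pos : ∀ n, 0 < a n
  summable : ∀ l : ℕ, Summable fun n : ℤ => |(n : ℝ)| ^ l * (|a n - 1 / 2| + |b n|)

/-- The Jacobi difference expression. -/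
def jacobiOp (a b : ℤ → ℝ) (f : ℤ → ℂ) (n : ℤ) : ℂ :=
  a n * f (n + 1) + a (n - 1) * f (n - 1) + b n * f n

/-- `u` solves `H u = ((z + z⁻¹) / 2) u`. -/
def IsJacobiSolution (a b : ℤ → ℝ) (z : ℂ) (u : ℤ → ℂ) : Prop :=
  ∀ n, jacobiOp a b u n = (z + z⁻¹) / 2 * u n

/-- `u` is the solution with `z^{-n} u(n) → 1` as `n → +∞`. -/
def IsJostPlus (a b : ℤ → ℝ) (z : ℂ) (u : ℤ → ℂ) : Prop :=
  IsJacobiSolution a b z u ∧ Tendsto (fun n : ℤ => z ^ (-n) * u n) atTop (𝓝 1)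

/-- `u` is the solution with `z^{n} u(n) → 1` as `n → -∞`. -/
def IsJostMinus (a b : ℤ → ℝ) (z : ℂ) (u : ℤ → ℂ) : Prop :=
  IsJacobiSolution a b z u ∧ Tendsto (fun n : ℤ => z ^ n * u n) atBot (𝓝 1)

/-- The Jost function `ψ₊(z, ·)`, meaningful for `0 < |z| ≤ 1`,
where there is exactly one such solution. -/
noncomputable def jostPlus (a b : ℤ → ℝ) (z : ℂ) : ℤ → ℂ :=
  Classical.epsilon (IsJostPlus a b z)

/-- The Jost function `ψ₋(z, ·)`, meaningful for `0 < |z| ≤ 1`,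
where there is exactly one such solution. -/
noncomputable def jostMinus (a b : ℤ → ℝ) (z : ℂ) : ℤ → ℂ :=
  Classical.epsilon (IsJostMinus a b z)

/-- The modified Wronskian `a(n) (u(n) v(n+1) - u(n+1) v(n))`. -/
def jacobiWronskian (a : ℤ → ℝ) (u v : ℤ → ℂ) (n : ℤ) : ℂ :=
  a n * (u n * v (n + 1) - u (n + 1) * v n)

/-- The Wronskian of two solutions does not depend on `n`. -/
theorem jacobiWronskian_eq {a b : ℤ → ℝ} {z : ℂ} {u v : ℤ → ℂ}
    (hu : IsJacobiSolution a b z u) (hv : IsJacobiSolution a b z v) (n : ℤ) :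
    jacobiWronskian a u v n = jacobiWronskian a u v 0 := by
  have step : ∀ m : ℤ, jacobiWronskian a u v (m + 1) = jacobiWronskian a u v m := by
    intro m
    have h1 := hu (m + 1)
    have h2 := hv (m + 1)
    simp only [jacobiOp, add_sub_cancel_right] at h1 h2
    simp only [jacobiWronskian]
    linear_combination u (m + 1) * h2 - v (m + 1) * h1
  induction n using Int.induction_on with
  | zero => rfl
  | succ k ih => rw [step, ih]
  | pred k ih => rw [← ih, ← step (-(k : ℤ) - 1), sub_add_cancel]

/-- The transmission coefficient
`T(z) = (z⁻¹ - z) / (2 W(ψ₊(z), ψ₋(z)))`, for `0 < |z| ≤ 1`. That it is the `T` of the scattering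
relations on the unit circle is `scattering_relations` below; the formula is also its meromorphic
extension to the disc. At a zero of `W` (a pole of `T`) the value `0` is a mere convention, so
`T` is only ever used through limits. -/
noncomputable def transmission (a b : ℤ → ℝ) (z : ℂ) : ℂ :=
  (z⁻¹ - z) / (2 * jacobiWronskian a (jostPlus a b z) (jostMinus a b z) 0)

/-- The row vector `m(z, n)`, for `|z| ≠ 1`, `z ≠ 0`. -/
noncomputable def jostVector (a b : ℤ → ℝ) (n : ℤ) (z : ℂ) : Fin 2 → ℂ :=
  if ‖z‖ < 1 then
    ![transmission a b z * jostMinus a b z n * z ^ n, jostPlus a b z n * z ^ (-n)]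
  else
    ![jostPlus a b z⁻¹ n * z ^ n, transmission a b z⁻¹ * jostMinus a b z⁻¹ n * z ^ (-n)]

/-- Punctured neighbourhoods of `z₁` in the open unit disc. -/
noncomputable def nhdsInside (z₁ : ℂ) : Filter ℂ := 𝓝[{z | ‖z‖ < 1 ∧ z ≠ z₁}] z₁

/-- Punctured neighbourhoods of `z₁` in the exterior of the closed unit disc. -/
noncomputable def nhdsOutside (z₁ : ℂ) : Filter ℂ := 𝓝[{z | 1 < ‖z‖ ∧ z ≠ z₁}] z₁

/-- The sectionally meromorphic vector `f` takes the value `(0 0)` at `z₁`: off the unit circle this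
is the value after removing a removable singularity (a pole does not qualify), on the circle
it is the boundary value from at least one of the two sides. -/
def VanishesAt (f : ℂ → Fin 2 → ℂ) (z₁ : ℂ) : Prop :=
  (‖z₁‖ ≤ 1 ∧ Tendsto f (nhdsInside z₁) (𝓝 0)) ∨ (1 ≤ ‖z₁‖ ∧ Tendsto f (nhdsOutside z₁) (𝓝 0))

/-- A zero of exact first order along the filter `l` of approach to `z₁`:
`f(z) = c (z - z₁) + o(|z - z₁|)` with `c ≠ 0`. -/
def SimpleZeroAlong (f : ℂ → ℂ) (z₁ : ℂ) (l : Filter ℂ) : Prop :=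
  ∃ c : ℂ, c ≠ 0 ∧ Tendsto (fun z => f z / (z - z₁)) l (𝓝 c)

/-- The scattering relations: for `|z| = 1`, `z ≠ ±1`, the Wronskian of the Jost solutions does not
vanish, and `T ψ∓ = conj ψ± + R± ψ±` holds with `T = (z⁻¹ - z) / (2 W(ψ₊, ψ₋))`. -/
theorem scattering_relations {a b : ℤ → ℝ} (hpos : Tendsto a atTop (𝓝 (1 / 2)))
    (hneg : Tendsto a atBot (𝓝 (1 / 2))) {z : ℂ} (hz : ‖z‖ = 1) (hz1 : z ≠ 1) (hz2 : z ≠ -1)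
    {u v : ℤ → ℂ} (hu : IsJostPlus a b z u) (hv : IsJostMinus a b z v) :
    jacobiWronskian a u v 0 ≠ 0 ∧ ∃ Rp Rm : ℂ, ∀ n,
      (z⁻¹ - z) / (2 * jacobiWronskian a u v 0) * v n = star (u n) + Rp * u n ∧
      (z⁻¹ - z) / (2 * jacobiWronskian a u v 0) * u n = star (v n) + Rm * v n := by
  have hz0 : z ≠ 0 := by rintro rfl; simp at hz
  have hzc : star z = z⁻¹ := by
    rw [Complex.inv_def, Complex.normSq_eq_norm_sq, hz]; simp
  have hzc2 : star z⁻¹ = z := by rw [← hzc, star_star]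
  -- conjugates are solutions
  have hconj : ∀ w : ℤ → ℂ, IsJacobiSolution a b z w →
      IsJacobiSolution a b z (fun n => star (w n)) := by
    intro w hw n
    have h1 := congrArg star (hw n)
    simp only [jacobiOp, star_add, star_mul', star_div₀, hzc, hzc2] at h1
    simp only [jacobiOp]
    have ha : ∀ x : ℝ, star (x : ℂ) = x := fun x => Complex.conj_ofReal x
    have h2 : star (2 : ℂ) = 2 := by simp
    rw [ha, ha, ha, h2] at h1
    linear_combination h1
  have hpC : Tendsto (fun n => (a n : ℂ)) atTop (𝓝 ((1 / 2 : ℝ) : ℂ)) :=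
    (Complex.continuous_ofReal.tendsto _).comp hpos
  have hnC : Tendsto (fun n => (a n : ℂ)) atBot (𝓝 ((1 / 2 : ℝ) : ℂ)) :=
    (Complex.continuous_ofReal.tendsto _).comp hneg
  have hstarp : ∀ k : ℤ, star (z ^ k) = z ^ (-k) := by
    intro k; rw [star_zpow₀, hzc, inv_zpow, zpow_neg]
  -- the two diagonal Wronskians
  have hWu : jacobiWronskian a u (fun n => star (u n)) 0 = (z⁻¹ - z) / 2 := by
    have hU := hu.2
    have hU1 : Tendsto (fun n : ℤ => z ^ (-(n + 1)) * u (n + 1)) atTop (𝓝 1) :=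
      hU.comp (tendsto_atTop_add_const_right _ 1 tendsto_id)
    have hlim := hpC.mul (((hU.mul hU1.star).const_mul z⁻¹).sub ((hU1.mul hU.star).const_mul z))
    have hlim2 : Tendsto (fun _ : ℤ => jacobiWronskian a u (fun n => star (u n)) 0) atTop
        (𝓝 (((1 / 2 : ℝ) : ℂ) * (z⁻¹ * (1 * star 1) - z * (1 * star 1)))) := by
      refine hlim.congr fun n => ?_
      rw [← jacobiWronskian_eq hu.1 (hconj u hu.1) n]
      simp only [jacobiWronskian, star_mul', hstarp, neg_neg]
      have e1 : z ^ (n + 1) = z ^ n * z := zpow_add_one₀ hz0 n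
      have e2 : z ^ (-(n + 1)) = (z ^ n)⁻¹ * z⁻¹ := by rw [zpow_neg, e1, mul_inv]
      have e3 : z ^ n ≠ 0 := zpow_ne_zero _ hz0
      rw [e1, e2, zpow_neg]
      field_simp
    have := tendsto_nhds_unique hlim2 tendsto_const_nhds
    rw [← this]; simp; ring
  have hWv : jacobiWronskian a v (fun n => star (v n)) 0 = -((z⁻¹ - z) / 2) := by
    have hV := hv.2
    have hV1 : Tendsto (fun n : ℤ => z ^ (n + 1) * v (n + 1)) atBot (𝓝 1) :=
      hV.comp (tendsto_atBot_add_const_right _ 1 tendsto_id)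
    have hlim := hnC.mul (((hV.mul hV1.star).const_mul z).sub ((hV1.mul hV.star).const_mul z⁻¹))
    have hlim2 : Tendsto (fun _ : ℤ => jacobiWronskian a v (fun n => star (v n)) 0) atBot
        (𝓝 (((1 / 2 : ℝ) : ℂ) * (z * (1 * star 1) - z⁻¹ * (1 * star 1)))) := by
      refine hlim.congr fun n => ?_
      rw [← jacobiWronskian_eq hv.1 (hconj v hv.1) n]
      simp only [jacobiWronskian, star_mul', hstarp]
      have e1 : z ^ (n + 1) = z ^ n * z := zpow_add_one₀ hz0 n
      have e2 : z ^ (-(n + 1)) = (z ^ n)⁻¹ * z⁻¹ := by rw [zpow_neg, e1, mul_inv]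
      have e3 : z ^ n ≠ 0 := zpow_ne_zero _ hz0
      rw [e1, e2, zpow_neg]
      field_simp
    have := tendsto_nhds_unique hlim2 tendsto_const_nhds
    rw [← this]; simp; ring
  have hsw : ∀ w w' : ℤ → ℂ, jacobiWronskian a (fun n => star (w n)) (fun n => star (w' n)) 0 =
      star (jacobiWronskian a w w' 0) := by
    intro w w'
    have ha : ∀ x : ℝ, star (x : ℂ) = x := fun x => Complex.conj_ofReal x
    simp only [jacobiWronskian, star_mul', star_sub, ha]
  have hδ : z⁻¹ - z ≠ 0 := by
    intro h0
    have h1 : z * z = 1 := by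
      have := congrArg (· * z) h0
      simp only [sub_mul, inv_mul_cancel₀ hz0, zero_mul] at this
      linear_combination -this
    rcases mul_self_eq_one_iff.1 h1 with h | h
    · exact hz1 h
    · exact hz2 h
  have hW : jacobiWronskian a u v 0 ≠ 0 := by
    intro h0
    set p := jacobiWronskian a u (fun n => star (v n)) 0 with hp
    have hq : jacobiWronskian a (fun n => star (u n)) v 0 = star p := by
      have := hsw u (fun n => star (v n))
      simpa only [star_star] using this
    have pl : jacobiWronskian a u (fun n => star (u n)) 0 *
          jacobiWronskian a v (fun n => star (v n)) 0
        - jacobiWronskian a u v 0 *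
          jacobiWronskian a (fun n => star (u n)) (fun n => star (v n)) 0
        + p * jacobiWronskian a (fun n => star (u n)) v 0 = 0 := by
      rw [hp]; simp only [jacobiWronskian]; ring
    rw [h0, hq, hWu, hWv] at pl
    have hs : star ((z⁻¹ - z) / 2) = -((z⁻¹ - z) / 2) := by
      have h2 : star (2 : ℂ) = 2 := by simp
      rw [star_div₀, star_sub, hzc, hzc2, h2]; ring
    rw [← hs] at pl
    have k : ∀ w : ℂ, w * star w = ((Complex.normSq w : ℝ) : ℂ) := fun w => Complex.mul_conj w
    rw [k, k, zero_mul, sub_zero, ← Complex.ofReal_add, Complex.ofReal_eq_zero] at pl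
    have h3 : 0 < Complex.normSq ((z⁻¹ - z) / 2) :=
      Complex.normSq_pos.2 (div_ne_zero hδ two_ne_zero)
    have h4 := Complex.normSq_nonneg p
    linarith
  refine ⟨hW, -jacobiWronskian a (fun n => star (u n)) v 0 / jacobiWronskian a u v 0,
    -jacobiWronskian a u (fun n => star (v n)) 0 / jacobiWronskian a u v 0, fun n => ⟨?_, ?_⟩⟩
  · have e : (z⁻¹ - z) / 2 * v n = jacobiWronskian a u v 0 * star (u n)
        - jacobiWronskian a (fun n => star (u n)) v 0 * u n := by
      rw [← hWu, ← jacobiWronskian_eq hu.1 (hconj u hu.1) n, ← jacobiWronskian_eq hu.1 hv.1 n,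
        ← jacobiWronskian_eq (hconj u hu.1) hv.1 n]
      simp only [jacobiWronskian]; ring
    have e' : (z⁻¹ - z) * v n = 2 * (jacobiWronskian a u v 0 * star (u n)
        - jacobiWronskian a (fun n => star (u n)) v 0 * u n) := by linear_combination 2 * e
    rw [div_mul_eq_mul_div, e']
    field_simp
    ring
  · have e : (z⁻¹ - z) / 2 * u n = jacobiWronskian a u v 0 * star (v n)
        - jacobiWronskian a u (fun n => star (v n)) 0 * v n := by
      have hWv' : (z⁻¹ - z) / 2 = -jacobiWronskian a v (fun n => star (v n)) 0 := by
        rw [hWv, neg_neg]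
      rw [hWv', ← jacobiWronskian_eq hv.1 (hconj v hv.1) n, ← jacobiWronskian_eq hu.1 hv.1 n,
        ← jacobiWronskian_eq hu.1 (hconj v hv.1) n]
      simp only [jacobiWronskian]; ring
    have e' : (z⁻¹ - z) * u n = 2 * (jacobiWronskian a u v 0 * star (v n)
        - jacobiWronskian a u (fun n => star (v n)) 0 * v n) := by linear_combination 2 * e
    rw [div_mul_eq_mul_div, e']
    field_simp
    ring

/-! Inside the disc, vanishing of `z⁻ⁿψ₊(z, n)` at `z₁` excludes `z₁ = 0`, where this function has a
nonzero limit, and so gives `ψ₊(z₁, n) = 0`. Hence `W(z₁) = -a(n) ψ₊(z₁, n+1) ψ₋(z₁, n)`, and since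
`ψ₊` cannot vanish at two consecutive sites, `W(z₁)` and `ψ₋(z₁, n)` are zero together or not at
all. In both cases `ψ₋(z, n) / W(z)` has a finite nonzero limit at `z₁`. Thus `T ψ₋ zⁿ` is `z⁻¹ - z`
times a function with nonzero limit: it can vanish only at `z₁ = ±1`, and there to first order
(`simpleZero_components`).

The delicate case is a common zero, where `W` must be shown to have a simple zero. By
`scattering_relations` such a `z₁` is `±1` or lies in the open disc. Green's formula
(`IsJostPlus.green`) writes the slopes of `ψ₊(·, n)` and `ψ₋(·, n)` at `z₁` through sums of squares
times a common nonzero factor; at `±1` the divergent sums are replaced by an Abelian limit. Zeros in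
the disc are real, so the two contributions to the slope of `W` have the same sign and cannot cancel
(`exists_tendsto_jostWronskian_div`).

The analysis rests on `exists_jostFamily`: a Volterra equation gives Jost functions continuous up to
the circle, with errors summable in `n` uniformly in `z`. Results for `ψ₋` follow by `n ↦ -n`, and
those for `|z| > 1` by `z ↦ z⁻¹`. -/

/-! ### Discrete Volterra equations over a commutative Banach ring. -/

section Volterra

variable {B : Type*} [NormedCommRing B]

lemma norm_geom_sum_le [NormOneClass B] {x : B} (hx : ‖x‖ ≤ 1) (k : ℕ) :
    ‖∑ i ∈ Finset.range k, x ^ i‖ ≤ k := by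
  refine (norm_sum_le _ _).trans ?_
  calc ∑ i ∈ Finset.range k, ‖x ^ i‖ ≤ ∑ i ∈ Finset.range k, (1 : ℝ) :=
        Finset.sum_le_sum fun i _ => (norm_pow_le _ _).trans (pow_le_one₀ (norm_nonneg _) hx)
    _ = k := by simp

/-- The potential term of the recurrence. -/
def potentialTerm (p q : ℕ → B) (g : ℕ → B) (k : ℕ) : B := p k * g (k + 1) + q k * g k

/-- The summand of the discrete Volterra operator. -/
def volterraTerm (x : B) (p q : ℕ → B) (g : ℕ → B) (n k : ℕ) : B :=
  (∑ i ∈ Finset.range (k + 1), x ^ i) * potentialTerm p q g (n + k + 1)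

/-- The weight `k + 1` bounds the geometric sum uniformly for `‖x‖ ≤ 1`. Summing the series instead
would introduce `(1 - x)⁻¹`, which blows up at the spectral edges. -/
lemma norm_volterraTerm_le [NormOneClass B] {x : B} (hx : ‖x‖ ≤ 1) {p q : ℕ → B} {c : ℕ → ℝ}
    (hc : ∀ k, ‖p k‖ + ‖q k‖ ≤ c k) {g : ℕ → B} {M : ℝ} (hg : ∀ k, ‖g k‖ ≤ M) (n k : ℕ) :
    ‖volterraTerm x p q g n k‖ ≤ (k + 1) * c (n + k + 1) * M := by
  have hM : 0 ≤ M := (norm_nonneg _).trans (hg 0)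
  have h1 : ‖potentialTerm p q g (n + k + 1)‖ ≤ c (n + k + 1) * M := by
    refine (norm_add_le _ _).trans ?_
    calc _ ≤ ‖p (n + k + 1)‖ * M + ‖q (n + k + 1)‖ * M := by
          gcongr
          · exact (norm_mul_le _ _).trans (by gcongr; exact hg _)
          · exact (norm_mul_le _ _).trans (by gcongr; exact hg _)
      _ ≤ _ := by rw [← add_mul]; gcongr; exact hc _
  calc _ ≤ ‖∑ i ∈ Finset.range (k + 1), x ^ i‖ * ‖potentialTerm p q g (n + k + 1)‖ :=
        norm_mul_le _ _
    _ ≤ ((k + 1 : ℕ) : ℝ) * (c (n + k + 1) * M) := by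
        gcongr; exact norm_geom_sum_le hx _
    _ = _ := by push_cast; ring

lemma volterraTerm_sub (x : B) (p q : ℕ → B) (g g' : ℕ → B) (n k : ℕ) :
    volterraTerm x p q g n k - volterraTerm x p q g' n k =
      volterraTerm x p q (fun j => g j - g' j) n k := by
  simp only [volterraTerm, potentialTerm]; ring

lemma summable_volterraTerm [NormOneClass B] [CompleteSpace B] {x : B} (hx : ‖x‖ ≤ 1) {p q : ℕ → B} {c ε : ℕ → ℝ}
    (hc : ∀ k, ‖p k‖ + ‖q k‖ ≤ c k)
    (hs : ∀ n, HasSum (fun k : ℕ => ((k : ℝ) + 1) * c (n + k + 1)) (ε n))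
    {g : ℕ → B} {M : ℝ} (hg : ∀ k, ‖g k‖ ≤ M) (n : ℕ) : Summable (volterraTerm x p q g n) :=
  .of_norm_bounded ((hs n).summable.mul_right M) (norm_volterraTerm_le hx hc hg n)

lemma norm_tsum_volterraTerm_le [NormOneClass B] {x : B} (hx : ‖x‖ ≤ 1) {p q : ℕ → B} {c ε : ℕ → ℝ}
    (hc : ∀ k, ‖p k‖ + ‖q k‖ ≤ c k)
    (hs : ∀ n, HasSum (fun k : ℕ => ((k : ℝ) + 1) * c (n + k + 1)) (ε n))
    {g : ℕ → B} {M : ℝ} (hg : ∀ k, ‖g k‖ ≤ M) (n : ℕ) :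
    ‖∑' k, volterraTerm x p q g n k‖ ≤ ε n * M :=
  tsum_of_norm_bounded ((hs n).mul_right M) (norm_volterraTerm_le hx hc hg n)

/-- The discrete Volterra sum solves the inhomogeneous second order recurrence. -/
lemma tsum_volterraTerm_recurrence {x : B} {p q : ℕ → B} {g : ℕ → B}
    (hsum : ∀ n, Summable (volterraTerm x p q g n)) (n : ℕ) :
    ∑' k, volterraTerm x p q g n k = (1 + x) * ∑' k, volterraTerm x p q g (n + 1) k
      - x * ∑' k, volterraTerm x p q g (n + 2) k + potentialTerm p q g (n + 1) := by
  have h0 := (hsum n).tsum_eq_zero_add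
  have e0 : volterraTerm x p q g n 0 = potentialTerm p q g (n + 1) := by simp [volterraTerm]
  -- With `S_k = ∑_{i<k} xⁱ` this is `S_{k+2} = (1 + x) S_{k+1} - x S_k`.
  have key : ∀ k, volterraTerm x p q g n (k + 1) =
      (1 + x) * volterraTerm x p q g (n + 1) k - x *
        ((∑ i ∈ Finset.range k, x ^ i) * potentialTerm p q g (n + k + 2)) := by
    intro k
    simp only [volterraTerm]
    rw [show n + (k + 1) + 1 = n + k + 2 by ring, show n + 1 + k + 1 = n + k + 2 by ring,
      Finset.sum_range_succ, Finset.sum_range_succ]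
    ring
  -- The term `k = 0` is an empty geometric sum, so the series is the one for `n + 2` shifted by one
  -- index.
  have s2 : HasSum (fun k => (∑ i ∈ Finset.range k, x ^ i) * potentialTerm p q g (n + k + 2))
      (∑' k, volterraTerm x p q g (n + 2) k) := by
    rw [← hasSum_nat_add_iff' 1]
    simp only [Finset.range_one, Finset.sum_singleton, Finset.range_zero, Finset.sum_empty,
      zero_mul, sub_zero]
    have e : (fun k : ℕ => (∑ i ∈ Finset.range (k + 1), x ^ i) *
        potentialTerm p q g (n + (k + 1) + 2)) = volterraTerm x p q g (n + 2) := by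
      funext k
      simp only [volterraTerm]
      rw [show n + (k + 1) + 2 = n + 2 + k + 1 by ring]
    rw [e]
    exact (hsum (n + 2)).hasSum
  have s1 := (hsum (n + 1)).hasSum
  have h3 : ∑' k, volterraTerm x p q g n (k + 1) =
      (1 + x) * ∑' k, volterraTerm x p q g (n + 1) k
        - x * ∑' k, volterraTerm x p q g (n + 2) k := by
    simp_rw [key]
    exact ((s1.mul_left (1 + x)).sub (s2.mul_left x)).tsum_eq
  rw [h0, e0, h3]; ring

/-- Solution of the Volterra equation by contraction. -/
lemma exists_volterra_solution [NormOneClass B] [CompleteSpace B] {x : B} (hx : ‖x‖ ≤ 1) {p q : ℕ → B} {c ε : ℕ → ℝ}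
    (hc : ∀ k, ‖p k‖ + ‖q k‖ ≤ c k)
    (hs : ∀ n, HasSum (fun k : ℕ => ((k : ℝ) + 1) * c (n + k + 1)) (ε n))
    (hε : ∀ n, ε n ≤ 1 / 2) :
    ∃ g : ℕ → B, (∀ n, ‖g n - 1‖ ≤ 2 * ε n) ∧
      ∀ n, g n = (1 + x) * g (n + 1) - x * g (n + 2) + potentialTerm p q g (n + 1) := by
  have hc0 : ∀ k, 0 ≤ c k := fun k => (by positivity : 0 ≤ ‖p k‖ + ‖q k‖).trans (hc k)
  have hε0 : ∀ n, 0 ≤ ε n := fun n => (hs n).nonneg fun k => mul_nonneg (by positivity) (hc0 _)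
  have hb : ∀ (g : BoundedContinuousFunction ℕ B) n,
      ‖1 + ∑' k, volterraTerm x p q g n k‖ ≤ 1 + 1 / 2 * ‖g‖ := by
    intro g n
    refine (norm_add_le _ _).trans ?_
    rw [norm_one]
    gcongr
    exact (norm_tsum_volterraTerm_le hx hc hs g.norm_coe_le_norm n).trans
      (by gcongr; exact hε n)
  let Φ : BoundedContinuousFunction ℕ B → BoundedContinuousFunction ℕ B := fun g =>
    BoundedContinuousFunction.ofNormedAddCommGroup
      (fun n => 1 + ∑' k, volterraTerm x p q g n k) continuous_of_discreteTopology _ (hb g)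
  have hΦ : ContractingWith (1 / 2) Φ := by
    refine ⟨by rw [← NNReal.coe_lt_coe]; norm_num, LipschitzWith.of_dist_le_mul fun g g' => ?_⟩
    rw [BoundedContinuousFunction.dist_le (by positivity)]
    intro n
    have hsub := (((summable_volterraTerm hx hc hs g.norm_coe_le_norm n).hasSum).sub
      ((summable_volterraTerm hx hc hs g'.norm_coe_le_norm n).hasSum)).tsum_eq
    simp only [volterraTerm_sub] at hsub
    change dist (1 + ∑' k, volterraTerm x p q g n k) (1 + ∑' k, volterraTerm x p q g' n k) ≤ _
    rw [dist_add_left, dist_eq_norm, ← hsub]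
    refine (norm_tsum_volterraTerm_le hx hc hs (M := dist g g') (fun k => ?_) n).trans ?_
    · rw [← dist_eq_norm]; exact BoundedContinuousFunction.dist_coe_le_dist k
    · gcongr
      exact (hε n).trans (by norm_num)
  obtain ⟨g, hg⟩ : ∃ g, Φ g = g := ⟨_, hΦ.fixedPoint_isFixedPt⟩
  have hgn : ∀ n, g n = 1 + ∑' k, volterraTerm x p q g n k := fun n => by
    conv_lhs => rw [← hg]
    rfl
  -- The contraction constant `1 / 2` bounds the fixed point by `2`; this is the `2` in `2 * ε n`.
  have hnorm : ‖g‖ ≤ 2 := by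
    have : ‖g‖ ≤ 1 + 1 / 2 * ‖g‖ := by
      rw [BoundedContinuousFunction.norm_le (by positivity)]
      intro n; rw [hgn n]; exact hb g n
    linarith
  refine ⟨g, fun n => ?_, fun n => ?_⟩
  · rw [hgn n, add_sub_cancel_left]
    refine (norm_tsum_volterraTerm_le hx hc hs g.norm_coe_le_norm n).trans ?_
    rw [mul_comm]
    exact mul_le_mul_of_nonneg_right hnorm (hε0 n)
  · have := tsum_volterraTerm_recurrence
      (summable_volterraTerm hx hc hs g.norm_coe_le_norm (p := p) (q := q)) n
    rw [hgn n, this, hgn (n + 1), hgn (n + 2)]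
    ring

end Volterra

/-! ### Extension of a half-line solution to all of `ℤ`. -/

/-- A backward second order recurrence started from values on a half-line. -/
lemma exists_backward_extension {B : Type*} (step : ℤ → B → B → B) (N : ℤ) (G : ℕ → B) :
    ∃ f : ℤ → B, (∀ k : ℕ, f (N + k) = G k) ∧
      ∀ n ≤ N, f (n - 1) = step n (f n) (f (n + 1)) := by
  -- The state after `j` steps is the pair `(f (N - j), f (N - j + 1))`.
  let F : ℕ → B × B := fun j => Nat.rec (G 0, G 1)
    (fun j x => (step (N - j) x.1 x.2, x.1)) j
  have hF : ∀ j, F (j + 1) = (step (N - j) (F j).1 (F j).2, (F j).1) := fun j => rfl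
  let f : ℤ → B := fun n => if N ≤ n then G (n - N).toNat else (F (N - n).toNat).1
  have hf1 : ∀ k : ℕ, f (N + k) = G k := by
    intro k; simp [f]
  have hf2 : ∀ j : ℕ, f (N - j) = (F j).1 := by
    intro j
    rcases j with _ | j
    · simp [f, F]
    · have : ¬ N ≤ N - ((j + 1 : ℕ) : ℤ) := by push_cast; omega
      have e : (N - (N - ((j + 1 : ℕ) : ℤ))).toNat = j + 1 := by omega
      simp only [f, this, if_false, e]
  have hf3 : ∀ j : ℕ, f (N - j + 1) = (F j).2 := by
    intro j
    rcases j with _ | j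
    · simpa [F] using hf1 1
    · rw [hF, ← hf2 j]; congr 1; push_cast; ring
  refine ⟨f, hf1, fun n hn => ?_⟩
  obtain ⟨j, rfl⟩ : ∃ j : ℕ, n = N - j := ⟨(N - n).toNat, by omega⟩
  rw [hf2, hf3, show N - (j : ℤ) - 1 = N - ((j + 1 : ℕ) : ℤ) by push_cast; ring, hf2, hF]

/-! ### Decay of the coefficients, reflection, and the gauge factor. -/

/-- Polynomially decaying perturbations of the free Jacobi operator. -/
structure JacobiBound (a b : ℤ → ℝ) : Prop where
  pos : ∀ n, 0 < a n
  bound : ∃ C, ∀ n : ℤ, (|(n : ℝ)| + 1) ^ 6 * (|a n - 1 / 2| + |b n|) ≤ C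

/-- Each summand is bounded by its series, so the moments `l = 0` and `l = 6` suffice. -/
lemma JacobiDecay.jacobiBound {a b : ℤ → ℝ} (h : JacobiDecay a b) : JacobiBound a b := by
  refine ⟨h.pos, 64 * ((∑' n : ℤ, |(n : ℝ)| ^ 0 * (|a n - 1 / 2| + |b n|)) +
    ∑' n : ℤ, |(n : ℝ)| ^ 6 * (|a n - 1 / 2| + |b n|)), fun n => ?_⟩
  have h0 := (h.summable 0).le_tsum n fun j _ => by positivity
  have h6 := (h.summable 6).le_tsum n fun j _ => by positivity
  have hp : (|(n : ℝ)| + 1) ^ 6 ≤ 64 * (|(n : ℝ)| ^ 0 + |(n : ℝ)| ^ 6) := by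
    have := add_pow_le (abs_nonneg (n : ℝ)) zero_le_one 6
    norm_num at this ⊢
    nlinarith [pow_nonneg (abs_nonneg (n : ℝ)) 6]
  calc _ ≤ 64 * (|(n : ℝ)| ^ 0 + |(n : ℝ)| ^ 6) * (|a n - 1 / 2| + |b n|) := by gcongr
    _ = 64 * (|(n : ℝ)| ^ 0 * (|a n - 1 / 2| + |b n|) +
        |(n : ℝ)| ^ 6 * (|a n - 1 / 2| + |b n|)) := by ring
    _ ≤ _ := by gcongr

/-- Reflection `n ↦ -n` of the off-diagonal coefficients. -/
def reflectOff (a : ℤ → ℝ) (n : ℤ) : ℝ := a (-n - 1)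

/-- Reflection `n ↦ -n` of the diagonal coefficients. -/
def reflectDiag (b : ℤ → ℝ) (n : ℤ) : ℝ := b (-n)

/-- The off-diagonal coefficient `a n` belongs to the bond from `n` to `n + 1`, so reflection shifts
its index by one; `|n| + 1 ≤ 2 (|-n - 1| + 1)` absorbs the shift at the cost of `2 ^ 6 = 64`. -/
lemma JacobiBound.reflect {a b : ℤ → ℝ} (h : JacobiBound a b) :
    JacobiBound (reflectOff a) (reflectDiag b) := by
  obtain ⟨C, hC⟩ := h.bound
  refine ⟨fun n => h.pos _, 64 * C + C, fun n => ?_⟩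
  have h1 := hC (-n - 1)
  have h2 := hC (-n)
  simp only [reflectOff, reflectDiag]
  have e : |((-n : ℤ) : ℝ)| = |(n : ℝ)| := by push_cast; exact abs_neg _
  rw [e] at h2
  have hn : |(n : ℝ)| + 1 ≤ 2 * (|((-n - 1 : ℤ) : ℝ)| + 1) := by
    push_cast
    have := abs_sub_abs_le_abs_sub (n : ℝ) (-1)
    have h3 : |-(n : ℝ) - 1| = |(n : ℝ) - (-1)| := by rw [← abs_neg]; ring_nf
    rw [abs_neg, abs_one] at this
    rw [h3]
    have := abs_nonneg ((n : ℝ) - (-1))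
    linarith
  have h4 : (|(n : ℝ)| + 1) ^ 6 * |a (-n - 1) - 1 / 2| ≤ 64 * C := by
    calc _ ≤ (2 * (|((-n - 1 : ℤ) : ℝ)| + 1)) ^ 6 * |a (-n - 1) - 1 / 2| := by gcongr
      _ = 64 * ((|((-n - 1 : ℤ) : ℝ)| + 1) ^ 6 * |a (-n - 1) - 1 / 2|) := by ring
      _ ≤ _ := by
        gcongr
        refine le_trans ?_ h1
        gcongr
        linarith [abs_nonneg (b (-n - 1))]
  have h5 : (|(n : ℝ)| + 1) ^ 6 * |b (-n)| ≤ C := by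
    refine le_trans ?_ h2
    gcongr
    linarith [abs_nonneg (a (-n) - 1 / 2)]
  linarith [mul_add ((|(n : ℝ)| + 1) ^ 6) |a (-n - 1) - 1 / 2| |b (-n)|]

lemma JacobiBound.nat_bound {a b : ℤ → ℝ} (h : JacobiBound a b) :
    ∃ C, 0 ≤ C ∧ ∀ k : ℕ, |a k - 1 / 2| + |b k| ≤ C / ((k : ℝ) + 1) ^ 6 := by
  obtain ⟨C, hC⟩ := h.bound
  refine ⟨C, le_trans (by positivity) (hC 0), fun k => ?_⟩
  rw [le_div_iff₀ (by positivity)]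
  have := hC k
  rw [Int.cast_natCast, Nat.abs_cast] at this
  linarith

lemma summable_inv_succ_sq : Summable fun k : ℕ => 1 / ((k : ℝ) + 1) ^ 2 := by
  have := (summable_nat_add_iff 1).2 (Real.summable_one_div_nat_pow.2 (one_lt_two))
  simpa using this

lemma JacobiBound.tendsto_atTop {a b : ℤ → ℝ} (h : JacobiBound a b) :
    Tendsto a atTop (𝓝 (1 / 2)) := by
  obtain ⟨C, hC⟩ := h.bound
  have hC0 : 0 ≤ C := le_trans (by positivity) (hC 0)
  rw [tendsto_iff_dist_tendsto_zero]
  have h1 : Tendsto (fun n : ℤ => C / ((n : ℝ) + 1)) atTop (𝓝 0) :=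
    tendsto_const_nhds.div_atTop
      (tendsto_atTop_add_const_right _ _ tendsto_intCast_atTop_atTop)
  refine squeeze_zero' (.of_forall fun _ => dist_nonneg) ?_ h1
  filter_upwards [eventually_ge_atTop 0] with n hn
  have hn' : (0 : ℝ) ≤ n := by exact_mod_cast hn
  rw [Real.dist_eq, le_div_iff₀ (by positivity)]
  refine le_trans ?_ (hC n)
  rw [abs_of_nonneg hn', mul_comm]
  gcongr
  · exact le_self_pow₀ (by linarith) (by norm_num)
  · linarith [abs_nonneg (b n)]

lemma abs_log_le_two_mul {y : ℝ} (hy : |y - 1| ≤ 1 / 2) : |Real.log y| ≤ 2 * |y - 1| := by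
  have h := abs_le.1 hy
  have hy0 : 0 < y := by linarith
  rw [abs_le]
  constructor
  · have h1 := Real.one_sub_inv_le_log_of_pos hy0
    have h2 : -(2 * |y - 1|) ≤ 1 - y⁻¹ := by
      have : 1 - y⁻¹ = (y - 1) * y⁻¹ := by field_simp
      rw [this]
      have hi : y⁻¹ ≤ 2 := by rw [inv_le_comm₀ hy0 two_pos]; linarith
      have hi0 : 0 < y⁻¹ := inv_pos.2 hy0
      nlinarith [neg_abs_le (y - 1), abs_nonneg (y - 1)]
    linarith
  · have h1 := Real.log_le_sub_one_of_pos hy0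
    linarith [le_abs_self (y - 1), abs_nonneg (y - 1)]

/-- The infinite product `α(n) = ∏_{m ≥ n} (2 a(m))⁻¹`. -/
lemma JacobiBound.exists_gauge {a b : ℤ → ℝ} (h : JacobiBound a b) :
    ∃ α : ℤ → ℝ, (∀ n, α (n + 1) = 2 * a n * α n) ∧
      ∃ (N : ℕ) (K : ℝ), 0 ≤ K ∧ ∀ k : ℕ, N ≤ k → |α k - 1| ≤ K / ((k : ℝ) + 1) ^ 2 := by
  obtain ⟨C, hC0, hC⟩ := h.nat_bound
  have hlim : Tendsto (fun k : ℕ => a k) atTop (𝓝 (1 / 2)) :=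
    h.tendsto_atTop.comp tendsto_natCast_atTop_atTop
  have hev : ∀ᶠ k : ℕ in atTop, |2 * a k - 1| ≤ 1 / 2 := by
    have := (hlim.const_mul 2).sub_const 1
    norm_num at this
    filter_upwards [this.abs.eventually (ge_mem_nhds (by norm_num : |(0 : ℝ)| < 1 / 2))] with k hk
    exact hk
  obtain ⟨N₀, hN₀⟩ := eventually_atTop.1 hev
  -- Four powers of the decay are split into two for the rate in `k` and two for summability in `j`.
  have hlog : ∀ k : ℕ, N₀ ≤ k → ∀ j : ℕ, |Real.log (2 * a ((k + j : ℕ) : ℤ))| ≤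
      4 * C / ((k : ℝ) + 1) ^ 2 * (1 / ((j : ℝ) + 1) ^ 2) := by
    intro k hk j
    refine (abs_log_le_two_mul (hN₀ (k + j) (by omega))).trans ?_
    have h1 : |2 * a ((k + j : ℕ) : ℤ) - 1| = 2 * |a ((k + j : ℕ) : ℤ) - 1 / 2| := by
      rw [← abs_two, ← abs_mul, abs_two]; ring_nf
    have h2 := hC (k + j)
    have h3 := abs_nonneg (b ((k + j : ℕ) : ℤ))
    have h4 : C / (((k + j : ℕ) : ℝ) + 1) ^ 6 ≤
        C / ((k : ℝ) + 1) ^ 2 * (1 / ((j : ℝ) + 1) ^ 2) := by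
      rw [div_mul_div_comm, mul_one]
      gcongr
      push_cast
      calc ((k : ℝ) + 1) ^ 2 * ((j : ℝ) + 1) ^ 2
          ≤ ((k : ℝ) + j + 1) ^ 2 * ((k : ℝ) + j + 1) ^ 2 := by gcongr <;> linarith
        _ = ((k : ℝ) + j + 1) ^ 4 := by ring
        _ ≤ _ := pow_le_pow_right₀ (by linarith [k.cast_nonneg (α := ℝ), j.cast_nonneg (α := ℝ)])
              (by norm_num)
    rw [h1]
    calc _ ≤ 4 * (C / ((k : ℝ) + 1) ^ 2 * (1 / ((j : ℝ) + 1) ^ 2)) := by linarith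
      _ = _ := by ring
  set L : ℤ → ℝ := fun m => Real.log (2 * a m) with hL
  have hsN : Summable fun j : ℕ => L ((N₀ + j : ℕ) : ℤ) :=
    .of_norm_bounded (summable_inv_succ_sq.mul_left _) (hlog N₀ le_rfl)
  have hs0 : Summable fun j : ℕ => L (j : ℤ) := by
    rw [← summable_nat_add_iff N₀]
    simpa only [add_comm] using hsN
  have hs : ∀ n : ℤ, Summable fun j : ℕ => L (n + j) := by
    intro n
    obtain ⟨i, m, him⟩ : ∃ i m : ℕ, n + i = m := ⟨n.natAbs, (n + n.natAbs).toNat, by omega⟩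
    rw [← summable_nat_add_iff i]
    convert (summable_nat_add_iff m).2 hs0 using 3 with j
    push_cast; linarith
  refine ⟨fun n => Real.exp (-∑' j : ℕ, L (n + j)), fun n => ?_, ?_⟩
  · have h1 := (hs n).tsum_eq_zero_add
    have h2 : ∀ j : ℕ, L (n + ((j + 1 : ℕ) : ℤ)) = L (n + 1 + j) := fun j => by
      congr 1; push_cast; ring
    simp_rw [h2] at h1
    have h3 : Real.exp (L n) = 2 * a n := Real.exp_log (by have := h.pos n; positivity)
    simp only [Nat.cast_zero, add_zero] at h1
    beta_reduce
    rw [h1, ← h3, ← Real.exp_add]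
    ring_nf
  · set Z := ∑' k : ℕ, 1 / ((k : ℝ) + 1) ^ 2
    have hZ0 : 0 ≤ Z := tsum_nonneg fun k => by positivity
    have htail : ∀ k : ℕ, N₀ ≤ k → |∑' j : ℕ, L ((k : ℤ) + j)| ≤
        4 * C / ((k : ℝ) + 1) ^ 2 * Z := fun k hk => by
      rw [← Real.norm_eq_abs]
      refine tsum_of_norm_bounded (summable_inv_succ_sq.hasSum.mul_left _) fun j => ?_
      have := hlog k hk j
      push_cast at this
      exact this
    -- Beyond `N₁` the exponent is at most `1` in absolute value, where `|exp y - 1| ≤ 2 |y|`.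
    obtain ⟨N₁, hN₁⟩ := exists_nat_ge (4 * C * Z)
    refine ⟨max N₀ N₁, 2 * (4 * C * Z), by positivity, fun k hk => ?_⟩
    have ht := htail k (le_trans (le_max_left _ _) hk)
    have hk1 : (N₁ : ℝ) ≤ k := by exact_mod_cast le_trans (le_max_right _ _) hk
    have e : 4 * C / ((k : ℝ) + 1) ^ 2 * Z = 4 * C * Z / ((k : ℝ) + 1) ^ 2 := by ring
    have h1 : 4 * C * Z / ((k : ℝ) + 1) ^ 2 ≤ 1 := by
      rw [div_le_one (by positivity)]
      nlinarith [k.cast_nonneg (α := ℝ)]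
    rw [e] at ht
    have h2 : |-∑' j : ℕ, L ((k : ℤ) + j)| ≤ 4 * C * Z / ((k : ℝ) + 1) ^ 2 := by
      rwa [abs_neg]
    refine (Real.abs_exp_sub_one_le (h2.trans h1)).trans ?_
    rw [mul_div_assoc]
    gcongr

/-! ### Construction of the Jost functions on the closed disc. -/

/-- The normalised Jost functions `f z n = z^{-n} ψ₊(z, n)` on the closed unit disc. -/
structure IsJostFamily (a b : ℤ → ℝ) (f : ℂ → ℤ → ℂ) : Prop where
  recurrence : ∀ z, ‖z‖ ≤ 1 → ∀ n, 2 * a (n - 1) * f z (n - 1) =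
    (1 + z ^ 2 - 2 * b n * z) * f z n - 2 * a n * z ^ 2 * f z (n + 1)
  continuousOn : ∀ n, ContinuousOn (fun z => f z n) (Metric.closedBall 0 1)
  bound : ∃ (N : ℤ) (M : ℝ), ∀ z, ‖z‖ ≤ 1 → ∀ k : ℕ, ‖f z (N + k) - 1‖ ≤ M / ((k : ℝ) + 1) ^ 2

/-- Writing `f = α g` with the gauge `α` makes the leading coefficients free: `g` satisfies the
recurrence with `1 + z²` and `z²`, perturbed by `1 - 4a²` and `-2b`. It is solved far to the right
by the Volterra equation and continued to the left by recursion. -/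
lemma JacobiBound.exists_jostFamily {a b : ℤ → ℝ} (h : JacobiBound a b) :
    ∃ f, IsJostFamily a b f := by
  obtain ⟨C, hC0, hC⟩ := h.nat_bound
  obtain ⟨α, hα, N₀, K₀, hK₀, hαb⟩ := h.exists_gauge
  set Z := ∑' k : ℕ, 1 / ((k : ℝ) + 1) ^ 2
  have hZ0 : 0 ≤ Z := tsum_nonneg fun k => by positivity
  set K := 4 * (1 + C) * C
  have hK : 0 ≤ K := by positivity
  have hcoef : ∀ k : ℕ, |1 - 4 * a k ^ 2| + |2 * b k| ≤ K / ((k : ℝ) + 1) ^ 6 := by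
    intro k
    have h1 := hC k
    have hCk : C / ((k : ℝ) + 1) ^ 6 ≤ C :=
      div_le_self hC0 (one_le_pow₀ (by linarith [k.cast_nonneg (α := ℝ)]))
    have h2 : |1 - 4 * a k ^ 2| ≤ 4 * (1 + C) * |a k - 1 / 2| := by
      rw [show 1 - 4 * a k ^ 2 = -(4 * (1 + (a k - 1 / 2))) * (a k - 1 / 2) by ring, abs_mul,
        abs_neg, abs_mul, abs_of_pos (by norm_num : (0 : ℝ) < 4)]
      gcongr
      refine (abs_add_le _ _).trans ?_
      rw [abs_one]
      linarith [abs_nonneg (b k)]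
    have h3 : |2 * b k| ≤ 4 * (1 + C) * |b k| := by
      rw [abs_mul, abs_two]
      gcongr
      linarith
    calc _ ≤ 4 * (1 + C) * (|a k - 1 / 2| + |b k|) := by linarith
      _ ≤ 4 * (1 + C) * (C / ((k : ℝ) + 1) ^ 6) := by gcongr
      _ = _ := by simp only [K]; ring
  -- Starting the Volterra equation at a site `N ≥ 2 K Z` makes its kernel sums at most `1 / 2`.
  obtain ⟨N₁, hN₁⟩ := exists_nat_ge (2 * (K * Z))
  set N := max N₀ N₁
  have hN1 : (N₁ : ℝ) ≤ N := by exact_mod_cast le_max_right _ _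
  let D := Metric.closedBall (0 : ℂ) 1
  -- The unknowns take values in the bounded continuous functions on the closed disc, and `x` is the
  -- coordinate `z`. One fixed point thus gives continuity in `z` and bounds uniform in `z`.
  let x : BoundedContinuousFunction D ℂ := BoundedContinuousFunction.ofNormedAddCommGroup
    (fun z => (z : ℂ)) continuous_subtype_val 1 fun z => mem_closedBall_zero_iff.1 z.2
  have hx : ‖x‖ ≤ 1 := by
    rw [BoundedContinuousFunction.norm_le zero_le_one]
    exact fun z => mem_closedBall_zero_iff.1 z.2
  have hxz : ∀ z, x z = z := fun z => rfl
  have : Nonempty D := ⟨⟨0, by simp [D]⟩⟩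
  have hx2 : ‖x ^ 2‖ ≤ 1 := (norm_pow_le _ _).trans (pow_le_one₀ (norm_nonneg _) hx)
  let c : ℕ → ℝ := fun k => K / ((N : ℝ) + k + 1) ^ 6
  have hc : ∀ k : ℕ, ‖((1 - 4 * a (N + k) ^ 2 : ℝ) : ℂ) • x ^ 2‖ +
      ‖((-(2 * b (N + k)) : ℝ) : ℂ) • x‖ ≤ c k := by
    intro k
    have := hcoef (N + k)
    push_cast at this
    refine le_trans ?_ this
    rw [norm_smul, norm_smul, Complex.norm_real, Complex.norm_real, norm_neg, Real.norm_eq_abs,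
      Real.norm_eq_abs]
    gcongr
    · exact mul_le_of_le_one_right (abs_nonneg _) hx2
    · exact mul_le_of_le_one_right (abs_nonneg _) hx
  have hterm : ∀ n k : ℕ, ((k : ℝ) + 1) * c (n + k + 1) ≤
      K / (((N : ℝ) + 1) * ((n : ℝ) + 1) ^ 2) * (1 / ((k : ℝ) + 1) ^ 2) := by
    intro n k
    simp only [c]
    have hn := n.cast_nonneg (α := ℝ)
    have hk := k.cast_nonneg (α := ℝ)
    have hN := N.cast_nonneg (α := ℝ)
    rw [← mul_div_assoc, div_mul_div_comm, mul_one, div_le_div_iff₀ (by positivity) (by positivity)]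
    push_cast
    set y := (N : ℝ) + (n + k + 1) + 1
    -- The six powers of `y` pay for the weight `k + 1`, the smallness `N + 1`, the rate `(n + 1)²`
    -- and the summability `(k + 1)²`.
    calc (k + 1 : ℝ) * K * ((N + 1) * (n + 1) ^ 2 * (k + 1) ^ 2)
        ≤ y * K * (y * y ^ 2 * y ^ 2) := by gcongr <;> simp only [y] <;> linarith
      _ = _ := by ring
  have hsum : ∀ n : ℕ, Summable fun k : ℕ => ((k : ℝ) + 1) * c (n + k + 1) := fun n =>
    .of_nonneg_of_le (fun k => by positivity) (hterm n) (summable_inv_succ_sq.mul_left _)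
  have hε : ∀ n : ℕ, ∑' k : ℕ, ((k : ℝ) + 1) * c (n + k + 1) ≤
      K * Z / (((N : ℝ) + 1) * ((n : ℝ) + 1) ^ 2) := by
    intro n
    refine ((hsum n).tsum_le_tsum (hterm n) (summable_inv_succ_sq.mul_left _)).trans ?_
    rw [tsum_mul_left]
    exact le_of_eq (by ring)
  have hε2 : ∀ n : ℕ, ∑' k : ℕ, ((k : ℝ) + 1) * c (n + k + 1) ≤ 1 / 2 := by
    intro n
    refine (hε n).trans ?_
    rw [div_le_div_iff₀ (by positivity) two_pos]
    have : (1 : ℝ) ≤ ((n : ℝ) + 1) ^ 2 := one_le_pow₀ (by linarith [n.cast_nonneg (α := ℝ)])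
    nlinarith [N.cast_nonneg (α := ℝ)]
  obtain ⟨G, hG1, hG2⟩ := exists_volterra_solution hx2 hc (fun n => (hsum n).hasSum) hε2
  obtain ⟨g, hg1, hg2⟩ := exists_backward_extension
    (fun n u v => (1 + x ^ 2) * u - x ^ 2 * v + (((1 - 4 * a n ^ 2 : ℝ) : ℂ) • x ^ 2 * v +
      ((-(2 * b n) : ℝ) : ℂ) • x * u)) (N : ℤ) G
  have hg : ∀ n, g (n - 1) = (1 + x ^ 2) * g n - x ^ 2 * g (n + 1) +
      (((1 - 4 * a n ^ 2 : ℝ) : ℂ) • x ^ 2 * g (n + 1) +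
      ((-(2 * b n) : ℝ) : ℂ) • x * g n) := by
    intro n
    rcases le_or_gt n N with hn | hn
    · exact hg2 n hn
    · obtain ⟨k, rfl⟩ : ∃ k : ℕ, n = N + (k + 1 : ℕ) := ⟨(n - N - 1).toNat, by omega⟩
      rw [show (N : ℤ) + (k + 1 : ℕ) - 1 = N + k by push_cast; ring,
        show (N : ℤ) + (k + 1 : ℕ) + 1 = N + (k + 2 : ℕ) by push_cast; ring, hg1, hg1, hg1, hG2 k]
      rfl
  classical
  refine ⟨fun z n => if hz : ‖z‖ ≤ 1 then α n * g n ⟨z, by simpa [D] using hz⟩ else 0,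
    ⟨fun z hz n => ?_, fun n => ?_, N, (1 + K₀) * (2 * (K * Z)) + K₀, fun z hz k => ?_⟩⟩
  · simp only [hz, dif_pos]
    have h1 := congrArg (fun w => w ⟨z, by simpa [D] using hz⟩) (hg n)
    simp only [BoundedContinuousFunction.coe_add, BoundedContinuousFunction.coe_sub,
      BoundedContinuousFunction.coe_mul, BoundedContinuousFunction.coe_smul,
      BoundedContinuousFunction.coe_pow, BoundedContinuousFunction.coe_one, Pi.add_apply,
      Pi.sub_apply, Pi.mul_apply, Pi.pow_apply, Pi.one_apply, smul_eq_mul, hxz] at h1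
    have h2 := hα n
    have h3 := hα (n - 1)
    rw [sub_add_cancel] at h3
    rw [h2, h1, h3]
    push_cast
    ring
  · rw [continuousOn_iff_continuous_domRestrict]
    have : Continuous fun z : D => (α n : ℂ) * g n z := continuous_const.mul (g n).continuous
    convert this using 2 with z
    have hz : ‖(z : ℂ)‖ ≤ 1 := mem_closedBall_zero_iff.1 z.2
    simp [hz]
  · simp only [hz, dif_pos]
    set w : D := ⟨z, by simpa [D] using hz⟩
    have hk := k.cast_nonneg (α := ℝ)
    have hN := N.cast_nonneg (α := ℝ)
    have h1 : |α (N + k) - 1| ≤ K₀ / ((k : ℝ) + 1) ^ 2 := by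
      have := hαb (N + k) ((le_max_left _ _).trans (Nat.le_add_right _ _))
      push_cast at this
      refine this.trans ?_
      gcongr
      linarith
    have h2 : ‖g (N + k) w - 1‖ ≤ 2 * (K * Z) / ((k : ℝ) + 1) ^ 2 := by
      rw [hg1]
      refine ((G k - 1).norm_coe_le_norm w).trans ((hG1 k).trans ?_)
      rw [mul_div_assoc]
      refine mul_le_mul_of_nonneg_left ((hε k).trans ?_) two_pos.le
      gcongr
      nlinarith [sq_nonneg ((k : ℝ) + 1)]
    have h3 : |α (N + k)| ≤ 1 + K₀ := by
      have h4 : K₀ / ((k : ℝ) + 1) ^ 2 ≤ K₀ := div_le_self hK₀ (one_le_pow₀ (by linarith))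
      calc |α (N + k)| = |1 + (α (N + k) - 1)| := by ring_nf
        _ ≤ |1| + |α (N + k) - 1| := abs_add_le _ _
        _ ≤ _ := by rw [abs_one]; linarith
    have h5 : (α (N + k) : ℂ) * g (N + k) w - 1 =
        α (N + k) * (g (N + k) w - 1) + ((α (N + k) - 1 : ℝ) : ℂ) := by push_cast; ring
    rw [h5]
    refine (norm_add_le _ _).trans ?_
    rw [norm_mul, Complex.norm_real, Complex.norm_real, Real.norm_eq_abs, Real.norm_eq_abs, add_div,
      mul_div_assoc]
    gcongr

section JostFamily

variable {a b : ℤ → ℝ} {f : ℂ → ℤ → ℂ}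

lemma IsJostFamily.tendsto_one (hf : IsJostFamily a b f) {z : ℂ} (hz : ‖z‖ ≤ 1) :
    Tendsto (f z) atTop (𝓝 1) := by
  obtain ⟨N, M, hM⟩ := hf.bound
  have h1 : Tendsto (fun k : ℕ => M / ((k : ℝ) + 1) ^ 2) atTop (𝓝 0) :=
    tendsto_const_nhds.div_atTop ((tendsto_pow_atTop two_ne_zero).comp
      (tendsto_atTop_add_const_right _ _ tendsto_natCast_atTop_atTop))
  have h2 : Tendsto (fun k : ℕ => f z (N + k)) atTop (𝓝 1) := by
    rw [tendsto_iff_norm_sub_tendsto_zero]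
    exact squeeze_zero (fun _ => norm_nonneg _) (hM z hz) h1
  have h3 : Tendsto (fun n : ℤ => (n - N).toNat) atTop atTop := by
    refine tendsto_atTop.2 fun m => ?_
    filter_upwards [eventually_ge_atTop (N + m)] with n hn
    omega
  refine (h2.comp h3).congr' ?_
  filter_upwards [eventually_ge_atTop N] with n hn
  simp only [Function.comp_apply]
  congr 1
  omega

lemma IsJostFamily.isJostPlus (hf : IsJostFamily a b f) {z : ℂ} (hz0 : z ≠ 0) (hz : ‖z‖ ≤ 1) :
    IsJostPlus a b z fun n => z ^ n * f z n := by
  refine ⟨fun n => ?_, (hf.tendsto_one hz).congr fun n => ?_⟩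
  · have h := hf.recurrence z hz n
    simp only [jacobiOp, zpow_add_one₀ hz0, zpow_sub_one₀ hz0]
    field_simp
    linear_combination h
  · rw [← mul_assoc, ← zpow_add₀ hz0]; simp

/-- Each step to the left adds one more term, bounded by compactness of the closed disc, so
summability uniform in `z` holds from every starting site. -/
lemma IsJostFamily.exists_bound (hf : IsJostFamily a b f) (n : ℤ) :
    ∃ e : ℕ → ℝ, Summable e ∧ ∀ z, ‖z‖ ≤ 1 → ∀ k : ℕ, ‖f z (n + k) - 1‖ ≤ e k := by
  obtain ⟨N, M, hM⟩ := hf.bound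
  induction n using Int.inductionOn' (b := N) with
  | zero =>
    refine ⟨fun k => M / ((k : ℝ) + 1) ^ 2, ?_, hM⟩
    simpa only [mul_one_div] using summable_inv_succ_sq.mul_left M
  | succ n _ ih =>
    obtain ⟨e, he, hb⟩ := ih
    refine ⟨fun k => e (k + 1), (summable_nat_add_iff 1).2 he, fun z hz k => ?_⟩
    have := hb z hz (k + 1)
    rwa [show n + ((k + 1 : ℕ) : ℤ) = n + 1 + k by push_cast; ring] at this
  | pred n _ ih =>
    obtain ⟨e, he, hb⟩ := ih
    obtain ⟨R, hR⟩ := (isCompact_closedBall (0 : ℂ) 1).exists_bound_of_continuousOn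
      ((hf.continuousOn (n - 1)).sub continuousOn_const (g := fun _ => (1 : ℂ)))
    refine ⟨fun k => Nat.casesOn k R e, (summable_nat_add_iff 1).1 he, fun z hz k => ?_⟩
    cases k with
    | zero => simpa using hR z (by simpa using hz)
    | succ k =>
      have := hb z hz k
      rwa [show n + (k : ℤ) = n - 1 + ((k + 1 : ℕ) : ℤ) by push_cast; ring] at this

/-- At `z = 0` the recurrence degenerates to `2 a(n-1) f(n-1) = f(n)`, so a zero propagates to the
right, against the limit `1`. -/
lemma IsJostFamily.apply_zero_ne_zero (hf : IsJostFamily a b f) (n : ℤ) : f 0 n ≠ 0 := by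
  intro h0
  have h1 : ∀ k : ℕ, f 0 (n + k) = 0 := by
    intro k
    induction k with
    | zero => simpa using h0
    | succ k ih =>
      have := hf.recurrence 0 (by simp) (n + (k + 1 : ℕ))
      rw [show n + ((k + 1 : ℕ) : ℤ) - 1 = n + k by push_cast; ring, ih] at this
      simpa using this.symm
  have h2 : Tendsto (fun k : ℕ => f 0 (n + k)) atTop (𝓝 1) :=
    (hf.tendsto_one (by simp)).comp
      (tendsto_atTop_add_const_left _ _ tendsto_natCast_atTop_atTop)
  simp only [h1] at h2
  exact zero_ne_one (tendsto_nhds_unique tendsto_const_nhds h2)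

end JostFamily

/-! ### Wronskians, uniqueness of Jost solutions, and Green's formula. -/

lemma IsJacobiSolution.eq_zero {a b : ℤ → ℝ} (ha : ∀ n, 0 < a n) {z : ℂ} {u : ℤ → ℂ}
    (hu : IsJacobiSolution a b z u) {n : ℤ} (h0 : u n = 0) (h1 : u (n + 1) = 0) (m : ℤ) :
    u m = 0 := by
  have ha' : ∀ n, (a n : ℂ) ≠ 0 := fun n => Complex.ofReal_ne_zero.2 (ha n).ne'
  suffices h : u m = 0 ∧ u (m + 1) = 0 from h.1
  induction m using Int.inductionOn' (b := n) with
  | zero => exact ⟨h0, h1⟩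
  | succ m _ ih =>
    refine ⟨ih.2, ?_⟩
    have := hu (m + 1)
    simp only [jacobiOp, add_sub_cancel_right, ih.1, ih.2, mul_zero, add_zero] at this
    exact (mul_eq_zero.1 this).resolve_left (ha' _)
  | pred m _ ih =>
    have := hu m
    simp only [jacobiOp, ih.1, ih.2, mul_zero, add_zero, zero_add] at this
    exact ⟨(mul_eq_zero.1 this).resolve_left (ha' _), by rw [sub_add_cancel]; exact ih.1⟩

/-- Asymptotics of the Wronskian of two Jost solutions with different spectral parameters. -/
lemma jacobiWronskian_eq_zpow_mul {a : ℤ → ℝ} {z w : ℂ} (hz : z ≠ 0) (hw : w ≠ 0) (u v : ℤ → ℂ)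
    (n : ℤ) : jacobiWronskian a u v n = (z * w) ^ n * (a n *
      (w * ((z ^ (-n) * u n) * (w ^ (-(n + 1)) * v (n + 1))) -
        z * ((z ^ (-(n + 1)) * u (n + 1)) * (w ^ (-n) * v n)))) := by
  have h1 : z ^ n ≠ 0 := zpow_ne_zero _ hz
  have h2 : w ^ n ≠ 0 := zpow_ne_zero _ hw
  simp only [jacobiWronskian, zpow_neg, zpow_add_one₀ hz, zpow_add_one₀ hw, mul_zpow]
  field_simp

lemma IsJostPlus.tendsto_wronskian_factor {a b : ℤ → ℝ} (ha : Tendsto a atTop (𝓝 (1 / 2)))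
    {z w : ℂ} {u v : ℤ → ℂ} (hu : IsJostPlus a b z u) (hv : IsJostPlus a b w v) :
    Tendsto (fun n : ℤ => (a n : ℂ) *
      (w * ((z ^ (-n) * u n) * (w ^ (-(n + 1)) * v (n + 1))) -
        z * ((z ^ (-(n + 1)) * u (n + 1)) * (w ^ (-n) * v n)))) atTop
      (𝓝 (1 / 2 * (w - z))) := by
  have haC : Tendsto (fun n => (a n : ℂ)) atTop (𝓝 ((1 / 2 : ℝ) : ℂ)) :=
    (Complex.continuous_ofReal.tendsto _).comp ha
  have hs : Tendsto (fun n : ℤ => n + 1) atTop atTop :=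
    tendsto_atTop_add_const_right _ 1 tendsto_id
  have := haC.mul (((hu.2.mul (hv.2.comp hs)).const_mul w).sub
    (((hu.2.comp hs).mul hv.2).const_mul z))
  rw [mul_one, mul_one, mul_one, Complex.ofReal_div, Complex.ofReal_one, Complex.ofReal_ofNat] at this
  exact this

/-- Jost solutions are unique. -/
lemma IsJostPlus.unique {a b : ℤ → ℝ} (hpos : ∀ n, 0 < a n) (ha : Tendsto a atTop (𝓝 (1 / 2)))
    {z : ℂ} (hz0 : z ≠ 0) (hz : ‖z‖ ≤ 1) {u v : ℤ → ℂ} (hu : IsJostPlus a b z u)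
    (hv : IsJostPlus a b z v) : u = v := by
  have hW : ∀ n, jacobiWronskian a u v n = 0 := by
    have h1 : Tendsto (fun n => jacobiWronskian a u v n) atTop (𝓝 0) := by
      -- For equal parameters the limit `(w - z) / 2` is zero, while the prefactor `(z²)ⁿ` stays
      -- bounded even for `‖z‖ = 1`.
      have hlim := hu.tendsto_wronskian_factor ha hv
      rw [sub_self, mul_zero] at hlim
      rw [tendsto_zero_iff_norm_tendsto_zero] at hlim ⊢
      refine squeeze_zero' (.of_forall fun _ => norm_nonneg _) ?_ hlim
      filter_upwards [eventually_ge_atTop 0] with n hn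
      rw [jacobiWronskian_eq_zpow_mul hz0 hz0, norm_mul]
      refine mul_le_of_le_one_left (norm_nonneg _) ?_
      lift n to ℕ using hn
      rw [zpow_natCast, norm_pow, norm_mul]
      exact pow_le_one₀ (by positivity) (mul_le_one₀ hz (norm_nonneg _) hz)
    intro n
    rw [jacobiWronskian_eq hu.1 hv.1]
    simp_rw [jacobiWronskian_eq hu.1 hv.1] at h1
    exact tendsto_nhds_unique tendsto_const_nhds h1
  have hW' : ∀ n, u n * v (n + 1) = u (n + 1) * v n := fun n => by
    have := hW n
    rw [jacobiWronskian] at this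
    exact sub_eq_zero.1 ((mul_eq_zero.1 this).resolve_left
      (Complex.ofReal_ne_zero.2 (hpos n).ne'))
  have hv0 : ∀ᶠ n in atTop, v n ≠ 0 := by
    filter_upwards [hv.2.eventually_ne one_ne_zero] with n hn h0
    exact hn (by rw [h0, mul_zero])
  obtain ⟨N, hN⟩ := eventually_atTop.1 hv0
  have hq : ∀ n, N ≤ n → u n = u N / v N * v n := by
    intro n hn
    induction n, hn using Int.leInduction with
    | base => rw [div_mul_cancel₀ _ (hN N le_rfl)]
    | succ n hn ih =>
      have h1 := hW' n
      have h2 := hN n hn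
      rw [ih] at h1
      apply mul_right_cancel₀ h2
      rw [← h1]; ring
  have hq1 : u N / v N = 1 := by
    have h1 : Tendsto (fun n : ℤ => u N / v N * (z ^ (-n) * v n)) atTop (𝓝 1) := by
      refine hu.2.congr' ?_
      filter_upwards [eventually_ge_atTop N] with n hn
      rw [hq n hn]; ring
    have h2 := hv.2.const_mul (u N / v N)
    rw [mul_one] at h2
    exact tendsto_nhds_unique h2 h1
  have hdiff : IsJacobiSolution a b z fun n => u n - v n := by
    intro n
    have h1 := hu.1 n
    have h2 := hv.1 n
    simp only [jacobiOp] at h1 h2 ⊢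
    linear_combination h1 - h2
  have hz : ∀ n, N ≤ n → u n - v n = 0 := fun n hn => by rw [hq n hn, hq1]; ring
  funext m
  exact sub_eq_zero.1 (hdiff.eq_zero hpos (hz N le_rfl) (hz (N + 1) (by omega)) m)

lemma IsJacobiSolution.star {a b : ℤ → ℝ} {z : ℂ} {u : ℤ → ℂ} (hu : IsJacobiSolution a b z u) :
    IsJacobiSolution a b (star z) fun n => star (u n) := by
  intro n
  have h1 := congrArg Star.star (hu n)
  have hr : ∀ x : ℝ, Star.star (x : ℂ) = x := fun x => Complex.conj_ofReal x
  have h2 : Star.star (2 : ℂ) = 2 := by simp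
  simpa only [jacobiOp, star_add, star_mul', star_div₀, star_inv₀, hr, h2] using h1

lemma IsJostPlus.star {a b : ℤ → ℝ} {z : ℂ} {u : ℤ → ℂ} (hu : IsJostPlus a b z u) :
    IsJostPlus a b (star z) fun n => star (u n) := by
  refine ⟨hu.1.star, ?_⟩
  have := hu.2.star
  simpa only [star_mul', star_zpow₀, star_one] using this

lemma tendsto_zpow_int_atTop_zero {x : ℂ} (hx : ‖x‖ < 1) :
    Tendsto (fun n : ℤ => x ^ n) atTop (𝓝 0) := by
  have h1 : Tendsto (fun n : ℤ => n.toNat) atTop atTop := by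
    refine tendsto_atTop.2 fun m => ?_
    filter_upwards [eventually_ge_atTop (m : ℤ)] with n hn
    omega
  refine ((tendsto_pow_atTop_nhds_zero_of_norm_lt_one hx).comp h1).congr' ?_
  filter_upwards [eventually_ge_atTop 0] with n hn
  lift n to ℕ using hn
  simp

/-- Green's formula on the half-line for two decaying Jost solutions. -/
lemma IsJostPlus.green {a b : ℤ → ℝ} (ha : Tendsto a atTop (𝓝 (1 / 2)))
    {z w : ℂ} (hz : z ≠ 0) (hw : w ≠ 0) (hzw : ‖z * w‖ < 1) {u v : ℤ → ℂ}
    (hu : IsJostPlus a b z u) (hv : IsJostPlus a b w v) (n : ℤ) :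
    (Summable fun k : ℕ => u (n + 1 + k) * v (n + 1 + k)) ∧
    jacobiWronskian a u v n = ((z + z⁻¹) / 2 - (w + w⁻¹) / 2) *
      ∑' k : ℕ, u (n + 1 + k) * v (n + 1 + k) := by
  have hnat : Tendsto (fun k : ℕ => n + 1 + (k : ℤ)) atTop atTop :=
    tendsto_atTop_add_const_left _ _ tendsto_natCast_atTop_atTop
  have hs : Summable fun k : ℕ => u (n + 1 + k) * v (n + 1 + k) := by
    have h1 := ((hu.2.mul hv.2).comp hnat).norm
    rw [mul_one, norm_one] at h1
    refine summable_of_isBigO_nat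
      ((summable_geometric_of_lt_one (norm_nonneg _) hzw).mul_left (‖(z * w) ^ (n + 1)‖ * 2)) ?_
    refine Asymptotics.IsBigO.of_bound 1 ?_
    filter_upwards [h1.eventually (ge_mem_nhds one_lt_two)] with k hk
    have e : u (n + 1 + k) * v (n + 1 + k) = (z * w) ^ (n + 1) * (z * w) ^ k *
        ((z ^ (-(n + 1 + (k : ℤ))) * u (n + 1 + k)) *
          (w ^ (-(n + 1 + (k : ℤ))) * v (n + 1 + k))) := by
      have h2 : z ^ (n + 1 + (k : ℤ)) ≠ 0 := zpow_ne_zero _ hz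
      have h3 : w ^ (n + 1 + (k : ℤ)) ≠ 0 := zpow_ne_zero _ hw
      rw [← zpow_natCast, ← zpow_add₀ (mul_ne_zero hz hw), mul_zpow, zpow_neg, zpow_neg]
      field_simp
    simp only [Function.comp_apply] at hk
    rw [e, norm_mul, norm_mul, one_mul, norm_pow, Real.norm_of_nonneg (by positivity)]
    calc _ ≤ ‖(z * w) ^ (n + 1)‖ * ‖z * w‖ ^ k * 2 := by gcongr
      _ = _ := by ring
  -- The Lagrange identity; it telescopes to the half-line sum because the Wronskian tends to zero
  -- at `+∞`.
  have hstep : ∀ m, jacobiWronskian a u v m - jacobiWronskian a u v (m + 1) =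
      ((z + z⁻¹) / 2 - (w + w⁻¹) / 2) * (u (m + 1) * v (m + 1)) := by
    intro m
    have h1 := hu.1 (m + 1)
    have h2 := hv.1 (m + 1)
    simp only [jacobiOp, add_sub_cancel_right] at h1 h2
    simp only [jacobiWronskian]
    linear_combination v (m + 1) * h1 - u (m + 1) * h2
  have hpart : ∀ K : ℕ, ((z + z⁻¹) / 2 - (w + w⁻¹) / 2) *
      ∑ k ∈ Finset.range K, u (n + 1 + k) * v (n + 1 + k) =
      jacobiWronskian a u v n - jacobiWronskian a u v (n + K) := by
    intro K
    induction K with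
    | zero => simp
    | succ K ih =>
      have := hstep (n + K)
      rw [Finset.sum_range_succ, mul_add, ih,
        show n + ((K + 1 : ℕ) : ℤ) = n + K + 1 by push_cast; ring,
        show n + 1 + (K : ℤ) = n + K + 1 by ring]
      linear_combination -this
  have hW0 : Tendsto (fun m => jacobiWronskian a u v m) atTop (𝓝 0) := by
    have h1 := (tendsto_zpow_int_atTop_zero hzw).mul (hu.tendsto_wronskian_factor ha hv)
    rw [zero_mul] at h1
    exact h1.congr fun m => (jacobiWronskian_eq_zpow_mul hz hw u v m).symm
  have hlim1 := hs.hasSum.tendsto_sum_nat.const_mul ((z + z⁻¹) / 2 - (w + w⁻¹) / 2)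
  simp_rw [hpart] at hlim1
  have hlim2 := (hW0.comp (tendsto_atTop_add_const_left _ n
    tendsto_natCast_atTop_atTop)).const_sub (jacobiWronskian a u v n)
  rw [sub_zero] at hlim2
  exact ⟨hs, tendsto_nhds_unique hlim2 hlim1⟩

/-! ### Dependence of `ψ₊` on `z`, and its zeros. -/

section JostFunctions

variable {a b : ℤ → ℝ} {f : ℂ → ℤ → ℂ}

lemma JacobiBound.isJostPlus_jostPlus (h : JacobiBound a b) {z : ℂ} (hz0 : z ≠ 0)
    (hz : ‖z‖ ≤ 1) : IsJostPlus a b z (jostPlus a b z) := by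
  obtain ⟨f, hf⟩ := h.exists_jostFamily
  exact Classical.epsilon_spec (p := IsJostPlus a b z) ⟨_, hf.isJostPlus hz0 hz⟩

lemma JacobiBound.jostPlus_eq (h : JacobiBound a b) (hf : IsJostFamily a b f) {z : ℂ}
    (hz0 : z ≠ 0) (hz : ‖z‖ ≤ 1) (n : ℤ) : jostPlus a b z n = z ^ n * f z n :=
  congrFun ((h.isJostPlus_jostPlus hz0 hz).unique h.pos h.tendsto_atTop hz0 hz
    (hf.isJostPlus hz0 hz)) n

lemma JacobiBound.continuousOn_jostPlus (h : JacobiBound a b) (n : ℤ) :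
    ContinuousOn (fun z => jostPlus a b z n) (Metric.closedBall 0 1 \ {0}) := by
  obtain ⟨f, hf⟩ := h.exists_jostFamily
  have h1 : ContinuousOn (fun z : ℂ => z ^ n * f z n) (Metric.closedBall 0 1 \ {0}) :=
    (continuousOn_id.zpow₀ n fun z hz => Or.inl hz.2).mul
      ((hf.continuousOn n).mono Set.sdiff_subset)
  exact h1.congr fun z hz => h.jostPlus_eq hf hz.2 (mem_closedBall_zero_iff.1 hz.1) n

lemma JacobiBound.star_jostPlus (h : JacobiBound a b) {z : ℂ} (hz0 : z ≠ 0) (hz : ‖z‖ ≤ 1)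
    (hreal : star z = z) (n : ℤ) : star (jostPlus a b z n) = jostPlus a b z n := by
  have h1 := (h.isJostPlus_jostPlus hz0 hz).star
  rw [hreal] at h1
  exact congrFun (h1.unique h.pos h.tendsto_atTop hz0 hz (h.isJostPlus_jostPlus hz0 hz)) n

/-- A Jost solution cannot vanish at two consecutive sites. -/
lemma IsJostPlus.succ_ne_zero (hpos : ∀ n, 0 < a n) {z : ℂ} {u : ℤ → ℂ}
    (hu : IsJostPlus a b z u) {n : ℤ} (h0 : u n = 0) : u (n + 1) ≠ 0 := by
  intro h1
  have h2 := hu.2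
  simp only [hu.1.eq_zero hpos h0 h1, mul_zero] at h2
  exact zero_ne_one (tendsto_nhds_unique tendsto_const_nhds h2)

lemma nhdsInside_le (z₁ : ℂ) : nhdsInside z₁ ≤ 𝓝 z₁ := nhdsWithin_le_nhds

lemma eventually_nhdsInside (z₁ : ℂ) : ∀ᶠ z in nhdsInside z₁, ‖z‖ < 1 ∧ z ≠ z₁ :=
  eventually_mem_nhdsWithin

lemma eventually_ne_zero_nhdsInside (z₁ : ℂ) : ∀ᶠ z in nhdsInside z₁, z ≠ 0 := by
  by_cases h : z₁ = 0
  · subst h; exact (eventually_nhdsInside 0).mono fun z hz => hz.2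
  · exact nhdsInside_le z₁ (isOpen_ne.mem_nhds h)

lemma JacobiBound.tendsto_jostPlus (h : JacobiBound a b) {z₁ : ℂ} (hz0 : z₁ ≠ 0)
    (hz : ‖z₁‖ ≤ 1) (n : ℤ) :
    Tendsto (fun z => jostPlus a b z n) (nhdsInside z₁) (𝓝 (jostPlus a b z₁ n)) := by
  have h1 := h.continuousOn_jostPlus n z₁ ⟨mem_closedBall_zero_iff.2 hz, hz0⟩
  refine h1.mono_left (le_inf (nhdsInside_le z₁) (le_principal_iff.2 ?_))
  filter_upwards [eventually_nhdsInside z₁, eventually_ne_zero_nhdsInside z₁] with z hz hz'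
  exact ⟨mem_closedBall_zero_iff.2 hz.1.le, hz'⟩

/-- A zero of a Jost function in the punctured open disc lies on the real axis. -/
lemma JacobiBound.star_eq_of_jostPlus_eq_zero (h : JacobiBound a b) {z : ℂ} (hz0 : z ≠ 0)
    (hz : ‖z‖ < 1) {n : ℤ} (h0 : jostPlus a b z n = 0) : star z = z := by
  have hu := h.isJostPlus_jostPlus hz0 hz.le
  set u := jostPlus a b z
  have hzz : ‖z * star z‖ < 1 := by
    rw [norm_mul, norm_star]
    nlinarith [norm_nonneg z]
  have hs0 : star z ≠ 0 := star_ne_zero.2 hz0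
  obtain ⟨hs, hW⟩ := hu.green h.tendsto_atTop hz0 hs0 hzz hu.star n
  have hW0 : jacobiWronskian a u (fun n => star (u n)) n = 0 := by
    simp [jacobiWronskian, h0]
  rw [hW0] at hW
  have e : ∀ k : ℕ, u (n + 1 + k) * star (u (n + 1 + k)) =
      ((Complex.normSq (u (n + 1 + k)) : ℝ) : ℂ) := fun k => Complex.mul_conj _
  have hs' : Summable fun k : ℕ => Complex.normSq (u (n + 1 + k)) := by
    rw [← Complex.summable_ofReal]
    simpa only [e] using hs
  have hpos : 0 < ∑' k : ℕ, Complex.normSq (u (n + 1 + k)) :=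
    hs'.tsum_pos (fun k => Complex.normSq_nonneg _) 0
      (by simpa using Complex.normSq_pos.2 (hu.succ_ne_zero h.pos h0))
  simp only [e] at hW
  rw [← Complex.ofReal_tsum] at hW
  have h2 := (mul_eq_zero.1 hW.symm).resolve_right (Complex.ofReal_ne_zero.2 hpos.ne')
  -- Green's formula for `z` and its conjugate forces the two spectral parameters to agree, which
  -- means `z` is real or `|z| = 1`.
  have h3 : (z - star z) * (z * star z - 1) = 0 := by
    field_simp at h2
    linear_combination h2
  rcases mul_eq_zero.1 h3 with h4 | h4
  · exact (sub_eq_zero.1 h4).symm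
  · rw [sub_eq_zero.1 h4, norm_one] at hzz
    exact absurd hzz (lt_irrefl _)

/-- The power series which governs `ψ₊(z, n)` near a zero `z₁`. -/
noncomputable def jostPairing (f : ℂ → ℤ → ℂ) (n : ℤ) (z₁ z : ℂ) : ℂ :=
  ∑' k : ℕ, (z₁ * z) ^ k * (f z₁ (n + 1 + k) * f z (n + 1 + k))

lemma JacobiBound.tsum_jostPlus_mul_eq (h : JacobiBound a b) (hf : IsJostFamily a b f)
    {z₁ z : ℂ} (hz0 : z₁ ≠ 0) (hz1 : ‖z₁‖ ≤ 1) (hw0 : z ≠ 0) (hw : ‖z‖ ≤ 1) (n : ℤ) :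
    ∑' k : ℕ, jostPlus a b z₁ (n + 1 + k) * jostPlus a b z (n + 1 + k) =
      (z₁ * z) ^ (n + 1) * jostPairing f n z₁ z := by
  rw [jostPairing, ← tsum_mul_left]
  refine tsum_congr fun k => ?_
  have h1 : (z₁ * z) ^ (n + 1) * (z₁ * z) ^ k = z₁ ^ (n + 1 + k) * z ^ (n + 1 + k) := by
    rw [← zpow_natCast, ← zpow_add₀ (mul_ne_zero hz0 hw0), mul_zpow]
  rw [h.jostPlus_eq hf hz0 hz1, h.jostPlus_eq hf hw0 hw]
  linear_combination (-(f z₁ (n + 1 + k) * f z (n + 1 + k))) * h1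

/-- This is Green's formula with `z₁` fixed and `z` variable: as `ψ₊(z₁, n) = 0`, only one product
survives in the Wronskian, and the difference of the spectral parameters contains `z - z₁`. -/
lemma JacobiBound.jostPlus_div_eq (h : JacobiBound a b) (hf : IsJostFamily a b f) {z₁ z : ℂ}
    (hz0 : z₁ ≠ 0) (hz1 : ‖z₁‖ ≤ 1) (hw0 : z ≠ 0) (hw : ‖z‖ < 1) (hne : z ≠ z₁) {n : ℤ}
    (h0 : jostPlus a b z₁ n = 0) :
    a n * jostPlus a b z₁ (n + 1) * (jostPlus a b z n / (z - z₁)) =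
      (1 - (z₁ * z)⁻¹) / 2 * (z₁ * z) ^ (n + 1) * jostPairing f n z₁ z := by
  have hu := h.isJostPlus_jostPlus hz0 hz1
  have hv := h.isJostPlus_jostPlus hw0 hw.le
  have hzw : ‖z₁ * z‖ < 1 := by
    rw [norm_mul]
    nlinarith [norm_nonneg z₁, norm_nonneg z]
  have hW := (hu.green h.tendsto_atTop hz0 hw0 hzw hv n).2
  rw [h.tsum_jostPlus_mul_eq hf hz0 hz1 hw0 hw.le, jacobiWronskian, h0] at hW
  have hd : z - z₁ ≠ 0 := sub_ne_zero.2 hne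
  have hl : (z₁ + z₁⁻¹) / 2 - (z + z⁻¹) / 2 = -((1 - (z₁ * z)⁻¹) / 2) * (z - z₁) := by
    field_simp; ring
  rw [hl] at hW
  rw [mul_div_assoc', div_eq_iff hd]
  linear_combination -hW

lemma IsJostFamily.exists_norm_le (hf : IsJostFamily a b f) (n : ℤ) :
    ∃ R : ℝ, 0 ≤ R ∧ ∀ z, ‖z‖ ≤ 1 → ∀ k : ℕ, ‖f z (n + k)‖ ≤ R := by
  obtain ⟨e, he, hb⟩ := hf.exists_bound n
  have he0 : ∀ k, 0 ≤ e k := fun k => (norm_nonneg _).trans (hb 0 (by simp) k)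
  refine ⟨1 + ∑' k, e k, add_nonneg zero_le_one (tsum_nonneg he0), fun z hz k => ?_⟩
  calc ‖f z (n + k)‖ = ‖1 + (f z (n + k) - 1)‖ := by ring_nf
    _ ≤ ‖(1 : ℂ)‖ + ‖f z (n + k) - 1‖ := norm_add_le _ _
    _ ≤ _ := by
      rw [norm_one]
      gcongr
      exact (hb z hz k).trans (he.le_tsum k fun j _ => he0 j)

lemma IsJostFamily.tendsto_nhdsInside (hf : IsJostFamily a b f) {z₁ : ℂ} (hz : ‖z₁‖ ≤ 1)
    (n : ℤ) : Tendsto (fun z => f z n) (nhdsInside z₁) (𝓝 (f z₁ n)) := by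
  refine (hf.continuousOn n z₁ (mem_closedBall_zero_iff.2 hz)).mono_left
    (le_inf (nhdsInside_le z₁) (le_principal_iff.2 ?_))
  filter_upwards [eventually_nhdsInside z₁] with z hz
  exact mem_closedBall_zero_iff.2 hz.1.le

lemma IsJostFamily.tendsto_jostPairing (hf : IsJostFamily a b f) (n : ℤ) {z₁ : ℂ}
    (hz : ‖z₁‖ < 1) :
    Tendsto (jostPairing f n z₁) (nhdsInside z₁) (𝓝 (jostPairing f n z₁ z₁)) := by
  obtain ⟨R, hR0, hR⟩ := hf.exists_norm_le (n + 1)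
  refine tendsto_tsum_of_dominated_convergence (bound := fun k : ℕ => ‖z₁‖ ^ k * (R * R))
    ((summable_geometric_of_lt_one (norm_nonneg _) hz).mul_right _) (fun k => ?_) ?_
  · exact ((tendsto_const_nhds.mul (tendsto_id.mono_left (nhdsInside_le z₁))).pow k).mul
      (tendsto_const_nhds.mul (hf.tendsto_nhdsInside hz.le _))
  · filter_upwards [eventually_nhdsInside z₁] with z hw k
    rw [norm_mul, norm_mul, norm_pow, norm_mul]
    gcongr
    · exact mul_le_of_le_one_right (norm_nonneg _) hw.1.le
    · exact hR _ hz.le k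
    · exact hR _ hw.1.le k

lemma norm_eq_one_of_sq_eq_one {s : ℂ} (hs : s ^ 2 = 1) : ‖s‖ = 1 := by
  have : ‖s‖ ^ 2 = 1 := by rw [← norm_pow, hs, norm_one]
  exact (pow_eq_one_iff_of_nonneg (norm_nonneg s) two_ne_zero).1 this

/-- An Abelian limit at the edges of the spectrum. -/
lemma IsJostFamily.tendsto_sub_mul_jostPairing (hf : IsJostFamily a b f) (n : ℤ) {s : ℂ}
    (hs : s ^ 2 = 1) :
    Tendsto (fun z => (z - s) * jostPairing f n s z) (nhdsInside s) (𝓝 (-s)) := by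
  have hs1 : ‖s‖ = 1 := norm_eq_one_of_sq_eq_one hs
  obtain ⟨R, hR0, hR⟩ := hf.exists_norm_le (n + 1)
  obtain ⟨e, he, hb⟩ := hf.exists_bound (n + 1)
  have hδ : ∀ z, ‖z‖ ≤ 1 → ∀ k : ℕ,
      ‖f s (n + 1 + k) * f z (n + 1 + k) - 1‖ ≤ (1 + R) * e k := by
    intro z hz k
    rw [show f s (n + 1 + k) * f z (n + 1 + k) - 1 =
      (f s (n + 1 + k) - 1) + f s (n + 1 + k) * (f z (n + 1 + k) - 1) by ring, add_mul, one_mul]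
    refine (norm_add_le _ _).trans ?_
    rw [norm_mul]
    gcongr
    · exact hb s hs1.le k
    · exact hR s hs1.le k
    · exact hb z hz k
  set ρ : ℂ → ℂ := fun z =>
    ∑' k : ℕ, (s * z) ^ k * (f s (n + 1 + k) * f z (n + 1 + k) - 1)
  have hρb : ∀ z, ‖z‖ < 1 → ∀ k : ℕ,
      ‖(s * z) ^ k * (f s (n + 1 + k) * f z (n + 1 + k) - 1)‖ ≤ (1 + R) * e k := by
    intro z hz k
    rw [norm_mul, norm_pow, norm_mul, hs1, one_mul]
    exact (mul_le_of_le_one_left (norm_nonneg _) (pow_le_one₀ (norm_nonneg _) hz.le)).trans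
      (hδ z hz.le k)
  have hρ : ∀ z, ‖z‖ < 1 → ‖ρ z‖ ≤ (1 + R) * ∑' k, e k := fun z hz =>
    tsum_of_norm_bounded (he.hasSum.mul_left _) (hρb z hz)
  -- The geometric series contributes `(z - s) / (1 - s z) = -s` exactly, by `s² = 1`. The remainder
  -- `ρ` is bounded on the whole disc, so no restriction on the direction of approach is needed.
  have heq : ∀ z, ‖z‖ < 1 ∧ z ≠ s → (z - s) * jostPairing f n s z = -s + (z - s) * ρ z := by
    intro z ⟨hz, hne⟩
    have hsz : ‖s * z‖ < 1 := by rwa [norm_mul, hs1, one_mul]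
    have h1 := (hasSum_geometric_of_norm_lt_one hsz).add
      (Summable.of_norm_bounded (he.mul_left _) (hρb z hz)).hasSum
    have h2 : jostPairing f n s z = (1 - s * z)⁻¹ + ρ z := by
      rw [← h1.tsum_eq]
      exact tsum_congr fun k => by ring
    have h3 : 1 - s * z ≠ 0 := by
      intro h
      rw [← sub_eq_zero.1 h, norm_one] at hsz
      exact lt_irrefl _ hsz
    rw [h2, mul_add]
    congr 1
    rw [← div_eq_mul_inv, div_eq_iff h3]
    linear_combination (-z) * hs
  have hz0 : Tendsto (fun z : ℂ => z - s) (nhdsInside s) (𝓝 0) := by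
    have : Tendsto (fun z : ℂ => z - s) (nhdsInside s) (𝓝 (s - s)) :=
      (show Tendsto id (nhdsInside s) (𝓝 s) from nhdsInside_le s).sub_const s
    rwa [sub_self] at this
  have hprod : Tendsto (fun z => (z - s) * ρ z) (nhdsInside s) (𝓝 0) := by
    refine hz0.zero_mul_isBoundedUnder_le ⟨(1 + R) * ∑' k, e k, ?_⟩
    rw [eventually_map]
    filter_upwards [eventually_nhdsInside s] with z hz
    exact hρ z hz.1
  have hlim := hprod.const_add (-s)
  rw [add_zero] at hlim
  refine hlim.congr' ?_
  filter_upwards [eventually_nhdsInside s] with z hz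
  exact (heq z hz).symm

end JostFunctions

/-! ### Simplicity of the zeros of `ψ₊(·, n)`. -/

section SimpleZeros

variable {a b : ℤ → ℝ}

/-- The universal factor in the first order expansion of Jost functions at their zeros. -/
noncomputable def zeroFactor (z : ℂ) : ℂ := if ‖z‖ < 1 then (1 - (z * z)⁻¹) / 2 else -(1 / 2)

lemma zeroFactor_ne_zero {z : ℂ} : zeroFactor z ≠ 0 := by
  unfold zeroFactor
  split_ifs with h
  · intro h0
    have h1 : (z * z)⁻¹ = 1 := by linear_combination (-2) * h0
    have h2 : ‖z * z‖ = 1 := by rw [inv_eq_one.1 h1, norm_one]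
    rw [norm_mul] at h2
    nlinarith [norm_nonneg z]
  · norm_num

lemma tendsto_id_nhdsInside (z₁ : ℂ) : Tendsto (fun z => z) (nhdsInside z₁) (𝓝 z₁) :=
  nhdsInside_le z₁

/-- A Jost function has only simple zeros in `z`, in the open disc and at `z = ±1`. -/
lemma JacobiBound.exists_simpleZero_jostPlus (h : JacobiBound a b) {z₁ : ℂ} (hz0 : z₁ ≠ 0)
    (hz : ‖z₁‖ < 1 ∨ z₁ ^ 2 = 1) {n : ℤ} (h0 : jostPlus a b z₁ n = 0) :
    star z₁ = z₁ ∧ ∃ (S : ℝ) (c : ℂ), 0 < S ∧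
      a n * jostPlus a b z₁ (n + 1) * c = zeroFactor z₁ * S ∧
      Tendsto (fun z => jostPlus a b z n / (z - z₁)) (nhdsInside z₁) (𝓝 c) := by
  obtain ⟨f, hf⟩ := h.exists_jostFamily
  have hz1 : ‖z₁‖ ≤ 1 := hz.elim le_of_lt fun h => (norm_eq_one_of_sq_eq_one h).le
  have hu := h.isJostPlus_jostPlus hz0 hz1
  have hne : (a n : ℂ) * jostPlus a b z₁ (n + 1) ≠ 0 :=
    mul_ne_zero (Complex.ofReal_ne_zero.2 (h.pos n).ne') (hu.succ_ne_zero h.pos h0)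
  have hstar : star z₁ = z₁ := by
    rcases hz with hz | hz
    · exact h.star_eq_of_jostPlus_eq_zero hz0 hz h0
    · rcases mul_self_eq_one_iff.1 ((sq z₁).symm.trans hz) with rfl | rfl <;> simp
  refine ⟨hstar, ?_⟩
  have hid := tendsto_id_nhdsInside z₁
  have hpow : Tendsto (fun z => (z₁ * z) ^ (n + 1)) (nhdsInside z₁) (𝓝 ((z₁ * z₁) ^ (n + 1))) :=
    (hid.const_mul z₁).zpow₀ _ (Or.inl (mul_ne_zero hz0 hz0))
  have key : ∀ S : ℝ, Tendsto (fun z => (1 - (z₁ * z)⁻¹) / 2 * (z₁ * z) ^ (n + 1) *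
      jostPairing f n z₁ z) (nhdsInside z₁) (𝓝 (zeroFactor z₁ * S)) → 0 < S →
      ∃ (S : ℝ) (c : ℂ), 0 < S ∧ a n * jostPlus a b z₁ (n + 1) * c = zeroFactor z₁ * S ∧
      Tendsto (fun z => jostPlus a b z n / (z - z₁)) (nhdsInside z₁) (𝓝 c) := by
    intro S hS hS0
    refine ⟨S, zeroFactor z₁ * S / (a n * jostPlus a b z₁ (n + 1)), hS0,
      mul_div_cancel₀ _ hne, (hS.div_const _).congr' ?_⟩
    filter_upwards [eventually_nhdsInside z₁, eventually_ne_zero_nhdsInside z₁] with z hw hw0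
    rw [← h.jostPlus_div_eq hf hz0 hz1 hw0 hw.1 hw.2 h0, mul_div_cancel_left₀ _ hne]
  by_cases hlt : ‖z₁‖ < 1
  · have hzz : ‖z₁ * z₁‖ < 1 := by
      rw [norm_mul]
      nlinarith [norm_nonneg z₁]
    have hs := (hu.green h.tendsto_atTop hz0 hz0 hzz hu n).1
    have htsum := h.tsum_jostPlus_mul_eq hf hz0 hz1 hz0 hz1 n
    -- At real `z₁` the Jost function is real, so the bilinear sum in Green's formula is a sum of
    -- absolute squares, hence positive.
    have e : ∀ k : ℕ, jostPlus a b z₁ (n + 1 + k) * jostPlus a b z₁ (n + 1 + k) =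
        ((Complex.normSq (jostPlus a b z₁ (n + 1 + k)) : ℝ) : ℂ) := fun k => by
      rw [← Complex.mul_conj]
      congr 1
      exact (h.star_jostPlus hz0 hz1 hstar _).symm
    simp only [e] at hs htsum
    rw [Complex.summable_ofReal] at hs
    rw [← Complex.ofReal_tsum] at htsum
    refine key _ ?_ (hs.tsum_pos (fun k => Complex.normSq_nonneg _) 0
      (by simpa using Complex.normSq_pos.2 (hu.succ_ne_zero h.pos h0)))
    rw [htsum, zeroFactor, if_pos hlt, ← mul_assoc]
    exact (((((hid.const_mul z₁).inv₀ (mul_ne_zero hz0 hz0)).const_sub 1).div_const 2).mul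
      hpow).mul (hf.tendsto_jostPairing n hlt)
  · have hsq := hz.resolve_left hlt
    refine key 1 ?_ one_pos
    have h1 := (((hid.inv₀ hz0).mul hpow).mul
      (hf.tendsto_sub_mul_jostPairing n hsq)).const_mul (1 / 2)
    have e : 1 / 2 * (z₁⁻¹ * (z₁ * z₁) ^ (n + 1) * -z₁) = zeroFactor z₁ * ((1 : ℝ) : ℂ) := by
      rw [← sq, hsq, one_zpow, zeroFactor, if_neg hlt]
      push_cast
      field_simp
    rw [e] at h1
    refine h1.congr' ?_
    filter_upwards [eventually_ne_zero_nhdsInside z₁] with z hw0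
    -- At an edge the prefactor supplies the `z - z₁` that the Abelian limit of the divergent
    -- pairing requires.
    have : 1 - (z₁ * z)⁻¹ = z⁻¹ * (z - z₁) := by
      field_simp
      linear_combination hsq
    rw [this]
    ring

end SimpleZeros

/-! ### Transfer to `ψ₋` by reflection. -/

section Reflection

variable {a b : ℤ → ℝ}

lemma isJostMinus_iff_isJostPlus_reflect {z : ℂ} {u : ℤ → ℂ} :
    IsJostMinus a b z u ↔ IsJostPlus (reflectOff a) (reflectDiag b) z fun n => u (-n) := by
  have hop : ∀ n, jacobiOp (reflectOff a) (reflectDiag b) (fun n => u (-n)) n =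
      jacobiOp a b u (-n) := by
    intro n
    simp only [jacobiOp, reflectOff, reflectDiag]
    rw [show -(n - 1) - 1 = -n by ring, show -(n + 1) = -n - 1 by ring,
      show -(n - 1) = -n + 1 by ring]
    ring
  refine and_congr ⟨fun h n => (hop n).trans (h (-n)), fun h n => ?_⟩ ⟨fun h => ?_, fun h => ?_⟩
  · have := (hop (-n)).symm.trans (h (-n))
    simpa only [neg_neg] using this
  · exact h.comp tendsto_neg_atTop_atBot
  · have := h.comp tendsto_neg_atBot_atTop
    simpa only [Function.comp_def, neg_neg] using this

lemma JacobiBound.isJostMinus_jostMinus (h : JacobiBound a b) {z : ℂ} (hz0 : z ≠ 0)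
    (hz : ‖z‖ ≤ 1) : IsJostMinus a b z (jostMinus a b z) := by
  refine Classical.epsilon_spec (p := IsJostMinus a b z)
    ⟨fun n => jostPlus (reflectOff a) (reflectDiag b) z (-n), ?_⟩
  rw [isJostMinus_iff_isJostPlus_reflect]
  simpa only [neg_neg] using h.reflect.isJostPlus_jostPlus hz0 hz

lemma JacobiBound.jostMinus_eq (h : JacobiBound a b) {z : ℂ} (hz0 : z ≠ 0) (hz : ‖z‖ ≤ 1)
    (n : ℤ) : jostMinus a b z n = jostPlus (reflectOff a) (reflectDiag b) z (-n) := by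
  have h1 := isJostMinus_iff_isJostPlus_reflect.1 (h.isJostMinus_jostMinus hz0 hz)
  have h2 := congrFun (h1.unique h.reflect.pos h.reflect.tendsto_atTop hz0 hz
    (h.reflect.isJostPlus_jostPlus hz0 hz)) (-n)
  simpa only [neg_neg] using h2

lemma JacobiBound.tendsto_jostMinus (h : JacobiBound a b) {z₁ : ℂ} (hz0 : z₁ ≠ 0)
    (hz : ‖z₁‖ ≤ 1) (n : ℤ) :
    Tendsto (fun z => jostMinus a b z n) (nhdsInside z₁) (𝓝 (jostMinus a b z₁ n)) := by
  rw [h.jostMinus_eq hz0 hz]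
  refine (h.reflect.tendsto_jostPlus hz0 hz (-n)).congr' ?_
  filter_upwards [eventually_nhdsInside z₁, eventually_ne_zero_nhdsInside z₁] with z hw hw0
  exact (h.jostMinus_eq hw0 hw.1.le n).symm

lemma JacobiBound.star_jostMinus (h : JacobiBound a b) {z : ℂ} (hz0 : z ≠ 0) (hz : ‖z‖ ≤ 1)
    (hreal : star z = z) (n : ℤ) : star (jostMinus a b z n) = jostMinus a b z n := by
  rw [h.jostMinus_eq hz0 hz]
  exact h.reflect.star_jostPlus hz0 hz hreal _

lemma JacobiBound.exists_simpleZero_jostMinus (h : JacobiBound a b) {z₁ : ℂ} (hz0 : z₁ ≠ 0)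
    (hz : ‖z₁‖ < 1 ∨ z₁ ^ 2 = 1) {n : ℤ} (h0 : jostMinus a b z₁ n = 0) :
    ∃ (S : ℝ) (c : ℂ), 0 < S ∧
      a n * jostMinus a b z₁ (n + 1) * c = -(zeroFactor z₁ * S) ∧
      Tendsto (fun z => jostMinus a b z n / (z - z₁)) (nhdsInside z₁) (𝓝 c) := by
  have hz1 : ‖z₁‖ ≤ 1 := hz.elim le_of_lt fun h => (norm_eq_one_of_sq_eq_one h).le
  have h0' := h0
  rw [h.jostMinus_eq hz0 hz1] at h0'
  obtain ⟨-, S, c, hS, hc, hlim⟩ := h.reflect.exists_simpleZero_jostPlus hz0 hz h0'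
  rw [show -n + 1 = -(n - 1) by ring, ← h.jostMinus_eq hz0 hz1, reflectOff, neg_neg] at hc
  refine ⟨S, c, hS, ?_, hlim.congr' ?_⟩
  -- Reflection yields the neighbour `n - 1`. At a zero, `a(n) ψ(n+1) = -a(n-1) ψ(n-1)`, which
  -- produces the minus sign.
  · have h1 := (h.isJostMinus_jostMinus hz0 hz1).1 n
    rw [jacobiOp, h0, mul_zero, mul_zero, add_zero] at h1
    linear_combination c * h1 - hc
  · filter_upwards [eventually_nhdsInside z₁, eventually_ne_zero_nhdsInside z₁] with z hw hw0
    rw [h.jostMinus_eq hw0 hw.1.le]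

end Reflection

lemma nhdsInside_neBot {z₁ : ℂ} (hz : ‖z₁‖ ≤ 1) : (nhdsInside z₁).NeBot := by
  have h1 : Tendsto (fun k : ℕ => (1 / ((k : ℝ) + 1 + 1))) atTop (𝓝 0) := by
    have := (tendsto_add_atTop_iff_nat 1).2 (tendsto_one_div_add_atTop_nhds_zero_nat (𝕜 := ℝ))
    simpa using this
  have h1' : Tendsto (fun k : ℕ => ((1 / ((k : ℝ) + 1 + 1) : ℝ) : ℂ)) atTop (𝓝 0) :=
    (Complex.continuous_ofReal.tendsto' 0 0 Complex.ofReal_zero).comp h1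
  have hpos : ∀ k : ℕ, 0 < 1 / ((k : ℝ) + 1 + 1) := fun k => by positivity
  have hlt : ∀ k : ℕ, 1 / ((k : ℝ) + 1 + 1) < 1 := fun k => by
    rw [div_lt_one (by positivity)]
    linarith [k.cast_nonneg (α := ℝ)]
  rw [nhdsInside, ← mem_closure_iff_nhdsWithin_neBot]
  by_cases h0 : z₁ = 0
  · subst h0
    refine mem_closure_of_tendsto h1' (.of_forall fun k => ⟨?_, ?_⟩)
    · rw [Complex.norm_real, Real.norm_of_nonneg (hpos k).le]; exact hlt k
    · exact Complex.ofReal_ne_zero.2 (hpos k).ne'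
  · have h2 := (h1'.const_sub 1).mul_const z₁
    rw [sub_zero, one_mul] at h2
    refine mem_closure_of_tendsto h2 (.of_forall fun k => ⟨?_, fun h => ?_⟩)
    · rw [← Complex.ofReal_one, ← Complex.ofReal_sub, norm_mul, Complex.norm_real,
        Real.norm_of_nonneg (by linarith [hlt k])]
      nlinarith [hpos k, hlt k, norm_nonneg z₁]
    · have h3 : ((1 / ((k : ℝ) + 1 + 1) : ℝ) : ℂ) * z₁ = 0 := by linear_combination -h
      exact (mul_ne_zero (Complex.ofReal_ne_zero.2 (hpos k).ne') h0) h3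

/-! ### Zeros of the two components inside the disc. -/

section Components

variable {a b : ℤ → ℝ}

/-- `T(z) ψ₋(z, n) zⁿ`. -/
noncomputable def leftComponent (a b : ℤ → ℝ) (n : ℤ) (z : ℂ) : ℂ :=
  transmission a b z * jostMinus a b z n * z ^ n

/-- `ψ₊(z, n) z⁻ⁿ`. -/
noncomputable def rightComponent (a b : ℤ → ℝ) (n : ℤ) (z : ℂ) : ℂ :=
  jostPlus a b z n * z ^ (-n)

lemma JacobiBound.jostPlus_eq_zero_of_tendsto (h : JacobiBound a b) {n : ℤ} {z₁ : ℂ}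
    (hz : ‖z₁‖ ≤ 1) (hR : Tendsto (rightComponent a b n) (nhdsInside z₁) (𝓝 0)) :
    z₁ ≠ 0 ∧ jostPlus a b z₁ n = 0 := by
  have := nhdsInside_neBot hz
  have h0 : z₁ ≠ 0 := by
    rintro rfl
    obtain ⟨f, hf⟩ := h.exists_jostFamily
    refine hf.apply_zero_ne_zero n (tendsto_nhds_unique (hf.tendsto_nhdsInside hz n)
      (hR.congr' ?_))
    filter_upwards [eventually_nhdsInside 0] with z hw
    have := zpow_ne_zero n hw.2
    rw [rightComponent, h.jostPlus_eq hf hw.2 hw.1.le, zpow_neg]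
    field_simp
  refine ⟨h0, ?_⟩
  have h1 := (h.tendsto_jostPlus h0 hz n).mul
    ((tendsto_id_nhdsInside z₁).zpow₀ (-n) (Or.inl h0))
  exact (mul_eq_zero.1 (tendsto_nhds_unique h1 hR)).resolve_right (zpow_ne_zero _ h0)

/-- The Wronskian of the Jost functions at `n`. -/
noncomputable def jostWronskian (a b : ℤ → ℝ) (n : ℤ) (z : ℂ) : ℂ :=
  jacobiWronskian a (jostPlus a b z) (jostMinus a b z) n

lemma JacobiBound.transmission_eq (h : JacobiBound a b) (n : ℤ) {z : ℂ} (hz0 : z ≠ 0)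
    (hz : ‖z‖ ≤ 1) : transmission a b z = (z⁻¹ - z) / (2 * jostWronskian a b n z) := by
  rw [transmission, jostWronskian, jacobiWronskian_eq (h.isJostPlus_jostPlus hz0 hz).1
    (h.isJostMinus_jostMinus hz0 hz).1 n]

lemma JacobiBound.tendsto_jostWronskian (h : JacobiBound a b) (n : ℤ) {z₁ : ℂ} (hz0 : z₁ ≠ 0)
    (hz : ‖z₁‖ ≤ 1) :
    Tendsto (jostWronskian a b n) (nhdsInside z₁) (𝓝 (jostWronskian a b n z₁)) :=
  (((h.tendsto_jostPlus hz0 hz n).mul (h.tendsto_jostMinus hz0 hz (n + 1))).sub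
    ((h.tendsto_jostPlus hz0 hz (n + 1)).mul (h.tendsto_jostMinus hz0 hz n))).const_mul _

lemma JacobiBound.scattering_ne_zero (h : JacobiBound a b) (n : ℤ) {z : ℂ} (hz : ‖z‖ = 1)
    (hsq : z ^ 2 ≠ 1) : jostWronskian a b n z ≠ 0 := by
  have hz0 : z ≠ 0 := by rintro rfl; simp at hz
  have hbot : Tendsto a atBot (𝓝 (1 / 2)) := by
    have h1 := h.reflect.tendsto_atTop.comp
      (tendsto_neg_atBot_atTop.comp (tendsto_atBot_add_const_right _ (1 : ℤ) tendsto_id))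
    refine h1.congr fun n => ?_
    simp only [Function.comp_apply, reflectOff, id]
    congr 1
    ring
  rw [jostWronskian, jacobiWronskian_eq (h.isJostPlus_jostPlus hz0 hz.le).1
    (h.isJostMinus_jostMinus hz0 hz.le).1 n]
  exact (scattering_relations h.tendsto_atTop hbot hz (by rintro rfl; simp at hsq)
    (by rintro rfl; simp at hsq) (h.isJostPlus_jostPlus hz0 hz.le)
    (h.isJostMinus_jostMinus hz0 hz.le)).1

/-- First order expansion of the Wronskian at a common zero of both Jost functions. -/
lemma JacobiBound.exists_tendsto_jostWronskian_div (h : JacobiBound a b) {n : ℤ} {z₁ : ℂ}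
    (hz0 : z₁ ≠ 0) (hz : ‖z₁‖ < 1 ∨ z₁ ^ 2 = 1) (hp : jostPlus a b z₁ n = 0)
    (hm : jostMinus a b z₁ n = 0) :
    ∃ c d : ℂ, c ≠ 0 ∧ d ≠ 0 ∧
      Tendsto (fun z => jostMinus a b z n / (z - z₁)) (nhdsInside z₁) (𝓝 c) ∧
      Tendsto (fun z => jostWronskian a b n z / (z - z₁)) (nhdsInside z₁) (𝓝 d) := by
  have hz1 : ‖z₁‖ ≤ 1 := hz.elim le_of_lt fun h => (norm_eq_one_of_sq_eq_one h).le
  obtain ⟨hstar, S, c, hS, hc, hclim⟩ := h.exists_simpleZero_jostPlus hz0 hz hp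
  obtain ⟨S', c', hS', hc', hclim'⟩ := h.exists_simpleZero_jostMinus hz0 hz hm
  have hreal : ∀ w : ℂ, star w = w → ((w.re : ℝ) : ℂ) = w := fun w hw =>
    Complex.conj_eq_iff_re.1 hw
  have hP := hreal _ (h.star_jostPlus hz0 hz1 hstar (n + 1))
  have hQ := hreal _ (h.star_jostMinus hz0 hz1 hstar (n + 1))
  have hP0 := (h.isJostPlus_jostPlus hz0 hz1).succ_ne_zero h.pos hp
  have hplus := h.tendsto_jostPlus hz0 hz1 (n + 1)
  have hminus := h.tendsto_jostMinus hz0 hz1 (n + 1)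
  set P := jostPlus a b z₁ (n + 1)
  set Q := jostMinus a b z₁ (n + 1)
  have hκ := zeroFactor_ne_zero (z := z₁)
  have hSc : (S' : ℂ) ≠ 0 := Complex.ofReal_ne_zero.2 hS'.ne'
  have hQ0 : Q ≠ 0 := by
    intro h1
    rw [h1, mul_zero, zero_mul] at hc'
    exact mul_ne_zero hκ hSc (neg_eq_zero.1 hc'.symm)
  have hc0 : c' ≠ 0 := by
    rintro rfl
    rw [mul_zero] at hc'
    exact mul_ne_zero hκ hSc (neg_eq_zero.1 hc'.symm)
  refine ⟨c', a n * (c * Q - P * c'), hc0, fun h1 => ?_, hclim', ?_⟩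
  -- Multiplying the slope `a(n) (c Q - P c')` by `P Q` turns it into `zeroFactor z₁ * (S Q² + S'
  -- P²)`. As `P` and `Q` are real and `P ≠ 0`, the bracket is positive.
  · have h2 : zeroFactor z₁ * (S * Q ^ 2 + S' * P ^ 2) = 0 := by
      linear_combination P * Q * h1 - Q ^ 2 * hc + P ^ 2 * hc'
    have h3 := (mul_eq_zero.1 h2).resolve_left hκ
    rw [← hP, ← hQ] at h3
    have h4 : S * Q.re ^ 2 + S' * P.re ^ 2 = 0 := by exact_mod_cast h3
    have h5 : P.re ≠ 0 := fun h6 => hP0 (by rw [← hP, h6, Complex.ofReal_zero])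
    have : 0 < S * Q.re ^ 2 + S' * P.re ^ 2 := by positivity
    exact this.ne' h4
  · refine (((hclim.mul hminus).sub (hplus.mul hclim')).const_mul (a n : ℂ)).congr fun z => ?_
    rw [jostWronskian, jacobiWronskian]
    ring

lemma tendsto_inv_sub_div {z₁ : ℂ} (hz0 : z₁ ≠ 0) (hsq : z₁ ^ 2 = 1) :
    Tendsto (fun z => (z⁻¹ - z) / (z - z₁)) (nhdsInside z₁) (𝓝 (-2)) := by
  have hid := tendsto_id_nhdsInside z₁
  have h1 := ((hid.add_const z₁).mul (hid.inv₀ hz0)).neg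
  have e : -((z₁ + z₁) * z₁⁻¹) = -2 := by field_simp; ring
  rw [e] at h1
  refine h1.congr' ?_
  filter_upwards [eventually_nhdsInside z₁, eventually_ne_zero_nhdsInside z₁] with z hw hw0
  have := sub_ne_zero.2 hw.2
  field_simp
  linear_combination hsq

lemma JacobiBound.simpleZero_components (h : JacobiBound a b) {n : ℤ} {z₁ : ℂ} (hz : ‖z₁‖ ≤ 1)
    (hL : Tendsto (leftComponent a b n) (nhdsInside z₁) (𝓝 0))
    (hR : Tendsto (rightComponent a b n) (nhdsInside z₁) (𝓝 0)) :
    (z₁ = 1 ∨ z₁ = -1) ∧ SimpleZeroAlong (leftComponent a b n) z₁ (nhdsInside z₁) ∧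
      SimpleZeroAlong (rightComponent a b n) z₁ (nhdsInside z₁) := by
  have := nhdsInside_neBot hz
  obtain ⟨hz0, hp⟩ := h.jostPlus_eq_zero_of_tendsto hz hR
  have hid := tendsto_id_nhdsInside z₁
  have hpow : ∀ m : ℤ, Tendsto (fun z => z ^ m) (nhdsInside z₁) (𝓝 (z₁ ^ m)) := fun m =>
    hid.zpow₀ m (Or.inl hz0)
  have hwr := h.tendsto_jostWronskian n hz0 hz
  have hmin := h.tendsto_jostMinus hz0 hz n
  have hW : jostWronskian a b n z₁ =
      -(a n * jostPlus a b z₁ (n + 1) * jostMinus a b z₁ n) := by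
    rw [jostWronskian, jacobiWronskian, hp]; ring
  have hP0 := (h.isJostPlus_jostPlus hz0 hz).succ_ne_zero h.pos hp
  have ha : (a n : ℂ) ≠ 0 := Complex.ofReal_ne_zero.2 (h.pos n).ne'
  suffices hmain : z₁ ^ 2 = 1 ∧ SimpleZeroAlong (leftComponent a b n) z₁ (nhdsInside z₁) by
    refine ⟨mul_self_eq_one_iff.1 ((sq z₁).symm.trans hmain.1), hmain.2, ?_⟩
    obtain ⟨-, S, c, hS, hc, hlim⟩ := h.exists_simpleZero_jostPlus hz0 (Or.inr hmain.1) hp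
    refine ⟨c * z₁ ^ (-n), mul_ne_zero ?_ (zpow_ne_zero _ hz0),
      (hlim.mul (hpow (-n))).congr fun z => ?_⟩
    · rintro rfl
      rw [mul_zero] at hc
      exact mul_ne_zero zeroFactor_ne_zero (Complex.ofReal_ne_zero.2 hS.ne') hc.symm
    · rw [rightComponent]; ring
  by_cases hW0 : jostWronskian a b n z₁ = 0
  · have hm : jostMinus a b z₁ n = 0 := by
      rw [hW, neg_eq_zero] at hW0
      exact (mul_eq_zero.1 hW0).resolve_left (mul_ne_zero ha hP0)
    have hz' : ‖z₁‖ < 1 ∨ z₁ ^ 2 = 1 := by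
      by_contra! hcon
      exact h.scattering_ne_zero n (le_antisymm hz hcon.1) hcon.2 hW0
    obtain ⟨c, d, hc, hd, hclim, hdlim⟩ := h.exists_tendsto_jostWronskian_div hz0 hz' hp hm
    have hquot : Tendsto (fun z => z ^ n / 2 * ((jostMinus a b z n / (z - z₁)) /
        (jostWronskian a b n z / (z - z₁)))) (nhdsInside z₁) (𝓝 (z₁ ^ n / 2 * (c / d))) :=
      ((hpow n).div_const 2).mul (hclim.div hdlim hd)
    have hne : z₁ ^ n / 2 * (c / d) ≠ 0 :=
      mul_ne_zero (div_ne_zero (zpow_ne_zero _ hz0) two_ne_zero) (div_ne_zero hc hd)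
    -- Dividing `ψ₋` and `W` by `z - z₁` exposes their nonzero slopes, leaving `z⁻¹ - z` as the only
    -- factor that can vanish.
    have heq : ∀ᶠ z in nhdsInside z₁, leftComponent a b n z = (z⁻¹ - z) *
        (z ^ n / 2 * ((jostMinus a b z n / (z - z₁)) / (jostWronskian a b n z / (z - z₁)))) := by
      filter_upwards [eventually_nhdsInside z₁, eventually_ne_zero_nhdsInside z₁] with z hw hw0
      rw [leftComponent, h.transmission_eq n hw0 hw.1.le,
        div_div_div_cancel_right₀ (sub_ne_zero.2 hw.2)]
      ring
    have hsq : z₁ ^ 2 = 1 := by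
      have h1 := ((hid.inv₀ hz0).sub hid).mul hquot
      have h2 := tendsto_nhds_unique (hL.congr' heq) h1
      have h3 := (mul_eq_zero.1 h2.symm).resolve_right hne
      field_simp at h3
      linear_combination -h3
    refine ⟨hsq, -2 * (z₁ ^ n / 2 * (c / d)), mul_ne_zero (by norm_num) hne,
      ((tendsto_inv_sub_div hz0 hsq).mul hquot).congr' ?_⟩
    filter_upwards [heq] with z hw
    rw [hw]; ring
  · have hm : jostMinus a b z₁ n ≠ 0 := by
      intro hm
      rw [hW, hm, mul_zero, neg_zero] at hW0
      exact hW0 rfl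
    have hquot : Tendsto (fun z => jostMinus a b z n * z ^ n / (2 * jostWronskian a b n z))
        (nhdsInside z₁) (𝓝 (jostMinus a b z₁ n * z₁ ^ n / (2 * jostWronskian a b n z₁))) :=
      (hmin.mul (hpow n)).div (hwr.const_mul 2) (mul_ne_zero two_ne_zero hW0)
    have hne : jostMinus a b z₁ n * z₁ ^ n / (2 * jostWronskian a b n z₁) ≠ 0 :=
      div_ne_zero (mul_ne_zero hm (zpow_ne_zero _ hz0)) (mul_ne_zero two_ne_zero hW0)
    have heq : ∀ᶠ z in nhdsInside z₁, leftComponent a b n z = (z⁻¹ - z) *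
        (jostMinus a b z n * z ^ n / (2 * jostWronskian a b n z)) := by
      filter_upwards [eventually_nhdsInside z₁, eventually_ne_zero_nhdsInside z₁] with z hw hw0
      rw [leftComponent, h.transmission_eq n hw0 hw.1.le]
      ring
    have hsq : z₁ ^ 2 = 1 := by
      have h1 := ((hid.inv₀ hz0).sub hid).mul hquot
      have h2 := tendsto_nhds_unique (hL.congr' heq) h1
      have h3 := (mul_eq_zero.1 h2.symm).resolve_right hne
      field_simp at h3
      linear_combination -h3
    refine ⟨hsq, -2 * _, mul_ne_zero (by norm_num) hne,
      ((tendsto_inv_sub_div hz0 hsq).mul hquot).congr' ?_⟩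
    filter_upwards [heq] with z hw
    rw [hw]; ring

end Components

/-! ### Passage to the exterior of the disc by `z ↦ z⁻¹`. -/

section Inversion

lemma tendsto_inv_nhdsInside {z₁ : ℂ} (hz0 : z₁ ≠ 0) :
    Tendsto (fun z => z⁻¹) (nhdsInside z₁) (nhdsOutside z₁⁻¹) := by
  refine tendsto_nhdsWithin_iff.2 ⟨(tendsto_id_nhdsInside z₁).inv₀ hz0, ?_⟩
  filter_upwards [eventually_nhdsInside z₁, eventually_ne_zero_nhdsInside z₁] with z hw hw0
  refine ⟨?_, fun h => hw.2 (inv_injective h)⟩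
  rw [norm_inv]
  exact (one_lt_inv₀ (norm_pos_iff.2 hw0)).2 hw.1

lemma tendsto_inv_nhdsOutside {z₁ : ℂ} (hz0 : z₁ ≠ 0) :
    Tendsto (fun z => z⁻¹) (nhdsOutside z₁) (nhdsInside z₁⁻¹) := by
  refine tendsto_nhdsWithin_iff.2
    ⟨(show Tendsto id (nhdsOutside z₁) (𝓝 z₁) from nhdsWithin_le_nhds).inv₀ hz0, ?_⟩
  have h1 : ∀ᶠ z in nhdsOutside z₁, 1 < ‖z‖ ∧ z ≠ z₁ := eventually_mem_nhdsWithin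
  filter_upwards [h1] with z hw
  refine ⟨?_, fun h => hw.2 (inv_injective h)⟩
  rw [norm_inv]
  exact inv_lt_one_of_one_lt₀ hw.1

lemma SimpleZeroAlong.comp_inv {g : ℂ → ℂ} {s : ℂ} (hs : s ^ 2 = 1)
    (hg : SimpleZeroAlong g s (nhdsInside s)) :
    SimpleZeroAlong (fun z => g z⁻¹) s (nhdsOutside s) := by
  have hs0 : s ≠ 0 := by rintro rfl; simp at hs
  have hsinv : s⁻¹ = s := by
    field_simp
    exact hs.symm
  obtain ⟨c, hc, hlim⟩ := hg
  have hinv := tendsto_inv_nhdsOutside hs0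
  rw [hsinv] at hinv
  have hid : Tendsto (fun z : ℂ => z) (nhdsOutside s) (𝓝 s) := nhdsWithin_le_nhds
  have h1 := (hlim.comp hinv).mul ((hid.inv₀ hs0).const_mul (-s))
  refine ⟨c * (-s * s⁻¹), mul_ne_zero hc (mul_ne_zero (neg_ne_zero.2 hs0) (inv_ne_zero hs0)),
    h1.congr' ?_⟩
  have h2 : ∀ᶠ z in nhdsOutside s, 1 < ‖z‖ ∧ z ≠ s := eventually_mem_nhdsWithin
  filter_upwards [h2] with z hw
  have hz0 : z ≠ 0 := by
    rintro rfl
    exact absurd hw.1 (by simp)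
  have hd : z - s ≠ 0 := sub_ne_zero.2 hw.2
  have hd' : z⁻¹ - s ≠ 0 := fun h => hw.2 (by rw [← hsinv, ← sub_eq_zero.1 h, inv_inv])
  -- For `s² = 1` inversion fixes `s` and has derivative `-1` there, so it preserves simple zeros.
  have e : z⁻¹ - s = -s * z⁻¹ * (z - s) := by
    field_simp
    linear_combination -hs
  simp only [Function.comp_apply]
  rw [e] at hd' ⊢
  field_simp

end Inversion

section JostVector

variable {a b : ℤ → ℝ}

lemma jostVector_of_norm_lt_one (n : ℤ) {z : ℂ} (hz : ‖z‖ < 1) :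
    jostVector a b n z = ![leftComponent a b n z, rightComponent a b n z] := by
  rw [jostVector, if_pos hz]; rfl

lemma jostVector_of_one_lt_norm (n : ℤ) {z : ℂ} (hz : 1 < ‖z‖) :
    jostVector a b n z = ![rightComponent a b n z⁻¹, leftComponent a b n z⁻¹] := by
  rw [jostVector, if_neg (not_lt.2 hz.le), rightComponent, leftComponent, inv_zpow', neg_neg,
    inv_zpow']

lemma SimpleZeroAlong.congr' {f g : ℂ → ℂ} {z₁ : ℂ} {l : Filter ℂ}
    (hf : SimpleZeroAlong f z₁ l) (h : f =ᶠ[l] g) : SimpleZeroAlong g z₁ l := by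
  obtain ⟨c, hc, hlim⟩ := hf
  exact ⟨c, hc, hlim.congr' (h.mono fun z hz => by rw [hz])⟩

lemma exists_simpleZero_jostVector {n : ℤ} {s : ℂ} (hs : s = 1 ∨ s = -1) (hL : SimpleZeroAlong (leftComponent a b n) s (nhdsInside s))
    (hR : SimpleZeroAlong (rightComponent a b n) s (nhdsInside s)) :
    ∃ j : Fin 2, SimpleZeroAlong (fun z => jostVector a b n z j) s (nhdsInside s) ∧
      SimpleZeroAlong (fun z => jostVector a b n z j) s (nhdsOutside s) := by
  have hsq : s ^ 2 = 1 := by rcases hs with rfl | rfl <;> norm_num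
  -- Inversion swaps the components: entry `0` is the left one inside and the inverted right one
  -- outside, so simple zeros of both are used.
  refine ⟨0, hL.congr' ?_, (hR.comp_inv hsq).congr' ?_⟩
  · filter_upwards [eventually_nhdsInside s] with z hz
    rw [jostVector_of_norm_lt_one n hz.1]; rfl
  · have h2 : ∀ᶠ z in nhdsOutside s, 1 < ‖z‖ ∧ z ≠ s := eventually_mem_nhdsWithin
    filter_upwards [h2] with z hz
    rw [jostVector_of_one_lt_norm n hz.1]; rfl

lemma VanishesAt.components (h : JacobiBound a b) {n : ℤ} {z₁ : ℂ}
    (hm : VanishesAt (jostVector a b n) z₁) :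
    (z₁ = 1 ∨ z₁ = -1) ∧ SimpleZeroAlong (leftComponent a b n) z₁ (nhdsInside z₁) ∧
      SimpleZeroAlong (rightComponent a b n) z₁ (nhdsInside z₁) := by
  rcases hm with ⟨hz, hm⟩ | ⟨hz, hm⟩
  · rw [tendsto_pi_nhds] at hm
    refine h.simpleZero_components hz ((hm 0).congr' ?_) ((hm 1).congr' ?_) <;>
    · filter_upwards [eventually_nhdsInside z₁] with z hw
      rw [jostVector_of_norm_lt_one n hw.1]; rfl
  · have hz0 : z₁ ≠ 0 := by
      rintro rfl
      rw [norm_zero] at hz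
      exact absurd hz (by norm_num)
    have hinv := tendsto_inv_nhdsInside (inv_ne_zero hz0)
    rw [inv_inv] at hinv
    have hcomp := hm.comp hinv
    rw [tendsto_pi_nhds] at hcomp
    have hev : ∀ᶠ z in nhdsInside z₁⁻¹, jostVector a b n z⁻¹ =
        ![rightComponent a b n z, leftComponent a b n z] := by
      filter_upwards [eventually_nhdsInside z₁⁻¹, eventually_ne_zero_nhdsInside z₁⁻¹]
        with z hw hw0
      rw [jostVector_of_one_lt_norm, inv_inv]
      rw [norm_inv]
      exact (one_lt_inv₀ (norm_pos_iff.2 hw0)).2 hw.1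
    have hmain : (z₁⁻¹ = 1 ∨ z₁⁻¹ = -1) ∧
        SimpleZeroAlong (leftComponent a b n) z₁⁻¹ (nhdsInside z₁⁻¹) ∧
        SimpleZeroAlong (rightComponent a b n) z₁⁻¹ (nhdsInside z₁⁻¹) := by
      refine h.simpleZero_components (by rw [norm_inv]; exact inv_le_one_of_one_le₀ hz)
        ((hcomp 1).congr' ?_) ((hcomp 0).congr' ?_) <;>
      · filter_upwards [hev] with z hw
        simp only [Function.comp_apply]
        rw [hw]; rfl
    -- The interior argument applies at `z₁⁻¹`; since that point is `±1`, it coincides with `z₁`.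
    have e : z₁⁻¹ = z₁ := by
      rcases hmain.1 with h1 | h1
      · rw [h1, inv_eq_one.1 h1]
      · rw [h1, ← inv_inv z₁, h1]; norm_num
    rwa [e] at hmain

end JostVector

theorem lemma2p6 (a b : ℤ → ℝ → ℝ) (t : ℝ)
    (h : JacobiDecay (fun k => a k t) (fun k => b k t)) (n : ℤ) (z₁ : ℂ)
    (hm : VanishesAt (jostVector (fun k => a k t) (fun k => b k t) n) z₁) :
    (z₁ = 1 ∨ z₁ = -1) ∧
      ∃ j : Fin 2,
        SimpleZeroAlong (fun z => jostVector (fun k => a k t) (fun k => b k t) n z j) z₁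
            (nhdsInside z₁) ∧
          SimpleZeroAlong (fun z => jostVector (fun k => a k t) (fun k => b k t) n z j) z₁
            (nhdsOutside z₁) := by
  obtain ⟨hz, hL, hR⟩ := hm.components h.jacobiBound
  exact ⟨hz, exists_simpleZero_jostVector hz hL hR⟩
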